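/- There is an absolute constant $C>0$ such that for every $n$ and all isotropic log-concave probability measures $\mu,\nu$ on $\mathbb{R}^n$, $$d_{TV}(\mu,\nu)\le C\sqrt{n\,d_{BL}(\mu,\nu)} .$$ Here a Borel probability measure $\mu$ on $\mathbb{R}^n$ is log-concave if $\mu(\lambda A+(1-\lambda)B)\ge\mu(A)^{\lambda}\mu(B)^{1-\lambda}$ for all nonempty compact sets $A,B\subseteq\mathbb{R}^n$ and all $\lambda\in(0,1)$; it is isotropic if a random vector $X$ with law $\mu$ satisfies $\mathbb{E}X=0$ and $\mathbb{E}XX^{T}=I_n$; $d_{TV}(\mu,\nu)=2\sup_{A}|\mu(A)-\nu(A)|$, the supremum being over Borel sets $A\subseteq\mathbb{R}^n$; and $d_{BL}(\mu,\nu)=\sup\bigl\{\bigl|\int g\,d\mu-\int g\,d\nu\bigr| : \|g\|_{BL}\le 1\bigr\}$, where for $g:\mathbb{R}^n\to\mathbb{R}$ $$\|g\|_{BL}=\max\Bigl\{\|g\|_\infty,\ \sup_{x\ne y}\frac{|g(x)-g(y)|}{\|x-y\|}\Bigr\}$$ and $\|\cdot\|$ is the Euclidean norm on $\mathbb{R}^n$.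 -/

import Mathlib

open MeasureTheory
open scoped ENNReal Pointwise

/-- A Borel measure `μ` on `ℝⁿ` is log-concave: for all nonempty compact `A`, `B` and all
`t ∈ (0, 1)`, `μ (t A + (1 - t) B) ≥ μ(A) ^ t * μ(B) ^ (1 - t)` (Minkowski sum of sets). -/
def IsLogConcaveMeasure {n : ℕ} (μ : Measure (EuclideanSpace ℝ (Fin n))) : Prop :=
  ∀ A B : Set (EuclideanSpace ℝ (Fin n)), IsCompact A → IsCompact B → A.Nonempty → B.Nonempty →
    ∀ t : ℝ, 0 < t → t < 1 → μ A ^ t * μ B ^ (1 - t) ≤ μ (t • A + (1 - t) • B)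

/-- `μ` is isotropic: if `X` has law `μ`, then `X` is square integrable, `𝔼 X = 0` and
`𝔼 X Xᵀ` is the identity matrix. -/
structure IsIsotropicMeasure {n : ℕ} (μ : Measure (EuclideanSpace ℝ (Fin n))) : Prop where
  memLp_two : MemLp (fun x : EuclideanSpace ℝ (Fin n) => x) 2 μ
  mean_eq_zero : ∫ x, x ∂μ = 0
  second_moment : ∀ i j : Fin n, ∫ x, x i * x j ∂μ = (1 : Matrix (Fin n) (Fin n) ℝ) i j

/-- Total variation distance, `2 sup_A |μ(A) - ν(A)|` over the Borel sets `A`. -/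
noncomputable def tvDist {n : ℕ} (μ ν : Measure (EuclideanSpace ℝ (Fin n))) : ℝ :=
  2 * sSup {r : ℝ | ∃ A : Set (EuclideanSpace ℝ (Fin n)),
    MeasurableSet A ∧ r = |μ.real A - ν.real A|}

/-- Bounded Lipschitz norm: the maximum of the sup norm and of the best Lipschitz constant with
respect to the Euclidean norm (`∞` if `g` is unbounded or not Lipschitz). -/
noncomputable def blNorm {n : ℕ} (g : EuclideanSpace ℝ (Fin n) → ℝ) : ℝ≥0∞ :=
  max (⨆ x, ‖g x‖ₑ) (⨆ (x) (y) (_ : x ≠ y), ‖g x - g y‖ₑ / ‖x - y‖ₑ)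

/-- Bounded Lipschitz distance, `sup |∫ g dμ - ∫ g dν|` over the functions `g` with bounded
Lipschitz norm at most `1`. -/
noncomputable def blDist {n : ℕ} (μ ν : Measure (EuclideanSpace ℝ (Fin n))) : ℝ :=
  sSup {r : ℝ | ∃ g : EuclideanSpace ℝ (Fin n) → ℝ,
    blNorm g ≤ 1 ∧ r = |∫ x, g x ∂μ - ∫ x, g x ∂ν|}

/-!
Gaussian averaging at scale `t`, `P_t h (x) = 𝔼 h (x + t G)`, links the two distances. On the one
hand `P_t h` has Lipschitz constant `O(1 / t)` when `0 ≤ h ≤ 1`, in any dimension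
(`abs_gaussianAverage_sub_le`), so the integrals of `P_t h` against `μ` and `ν` differ by
`O(d_BL / t)`. On the other hand `∫ h dμ ≤ ∫ P_t h dμ + O(n t)` for isotropic log-concave `μ`
(`integral_le_integral_gaussianAverage_add`). Taking `t = √(d_BL / n)` gives the theorem.

The second estimate is about how much mass of a log-concave density `f` a Gaussian step can
displace. Suppose `a ≤ f` on the ball of radius `r` and `f ≤ b * a` everywhere. If
`Φ_s x = f (x / (1 + s)) ^ (1 + s) * a ^ (-s)` is less than `u` at `x`, a separating hyperplane
shows that `x` is `s * r` away, in some direction, from `{u < f}`, and a one-dimensional Gaussian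
tail, free of the dimension, bounds the probability that `x + t G` lands in `{u < f}`. Since
`∫ Φ_s ≤ exp ((n + log b) * s)`, the layer cake formula gives a displaced mass of order
`(n + log b) * t / r` (`IsLogConcaveDensity.lintegral_lintegral_increment_le`). No gradient of `f`
is needed.

For isotropic `f` one may take `r` absolute and `log b = O(n)`
(`IsLogConcaveDensity.exists_le_on_ball`): by `∫ √(f x * f y) dx ≤ 2 ^ n` a sublevel set
`{f < exp (-C n) sup f}` has tiny mass, while a point of the ball in it could be separated
from its convex complement by a halfspace whose mass is bounded below. The latter bound
(`le_measure_lt_inner`) follows from Borell's exponential tails of marginals.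

The definition of log-concavity for measures provides no density. It does make
`x ↦ μ (closedBall x ε)` log-concave, so the estimates are applied to the averages of `μ` over
small balls (`ballDensity`), and `ε` tends to `0` against Lipschitz test functions.
-/

/-! ### The Gaussian kernel -/

section GaussianKernel

variable {V : Type*} [NormedAddCommGroup V]

/-- The Gaussian density `exp (-π ‖v‖ ^ 2)`; with this choice of variance it has integral `1` in
every dimension. -/
noncomputable def gaussianWeight (v : V) : ℝ := Real.exp (-Real.pi * ‖v‖ ^ 2)

lemma gaussianWeight_pos (v : V) : 0 < gaussianWeight v := Real.exp_pos _

lemma continuous_gaussianWeight : Continuous (gaussianWeight : V → ℝ) := by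
  unfold gaussianWeight; fun_prop

variable [MeasurableSpace V] [BorelSpace V]

lemma measurable_ofReal_gaussianWeight :
    Measurable fun v : V => ENNReal.ofReal (gaussianWeight v) :=
  continuous_gaussianWeight.measurable.ennreal_ofReal

variable [InnerProductSpace ℝ V] [FiniteDimensional ℝ V]

lemma integral_gaussianWeight : ∫ v : V, gaussianWeight v = 1 := by
  simp only [gaussianWeight]
  rw [GaussianFourier.integral_rexp_neg_mul_sq_norm Real.pi_pos, div_self Real.pi_pos.ne',
    Real.one_rpow]

lemma integrable_gaussianWeight : Integrable (gaussianWeight : V → ℝ) := by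
  by_contra h
  simpa [integral_undef h] using integral_gaussianWeight (V := V)

/-- Translating the Gaussian by `w` changes it in `L¹` by `O(‖w‖)`, in every dimension. For small
`w` this is the chi-square bound `|p - q| ≤ (‖w‖ * p + (p - q) ^ 2 / (‖w‖ * p)) / 2`, whose right side
has an explicit integral. -/
lemma integral_abs_gaussianWeight_sub_le (w : V) :
    ∫ v : V, |gaussianWeight v - gaussianWeight (v - w)| ≤ 7 * ‖w‖ := by
  have hi := integrable_gaussianWeight (V := V)
  have hi1 : Integrable (fun v : V => gaussianWeight (v - w)) := hi.comp_sub_right w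
  have hi2 : Integrable (fun v : V => gaussianWeight (v - (2 : ℝ) • w)) := hi.comp_sub_right _
  have e1 : ∫ v : V, gaussianWeight (v - w) = 1 := by
    rw [integral_sub_right_eq_self (fun v : V => gaussianWeight v), integral_gaussianWeight]
  have e2 : ∫ v : V, gaussianWeight (v - (2 : ℝ) • w) = 1 := by
    rw [integral_sub_right_eq_self (fun v : V => gaussianWeight v), integral_gaussianWeight]
  rcases le_or_gt (1 / 3) ‖w‖ with hw | hw
  · calc ∫ v : V, |gaussianWeight v - gaussianWeight (v - w)|
        ≤ ∫ v : V, (gaussianWeight v + gaussianWeight (v - w)) := by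
          refine integral_mono (hi.sub hi1).abs (hi.add hi1) fun v => ?_
          have h1 := gaussianWeight_pos v
          have h2 := gaussianWeight_pos (v - w)
          exact abs_le.2 ⟨by simp only; linarith, by simp only; linarith⟩
      _ = 2 := by rw [integral_add hi hi1, e1, integral_gaussianWeight]; norm_num
      _ ≤ 7 * ‖w‖ := by linarith
  rcases eq_or_ne w 0 with rfl | hw0
  · simp
  have ha : 0 < ‖w‖ := norm_pos_iff.2 hw0
  set a := ‖w‖ with ha_def
  set c := Real.exp (2 * Real.pi * a ^ 2) with hc
  -- the square of the shifted density over the density is again a shifted Gaussian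
  have key : ∀ v : V, gaussianWeight (v - w) ^ 2
      = gaussianWeight v * (c * gaussianWeight (v - (2 : ℝ) • w)) := fun v => by
    simp only [gaussianWeight, hc, ← Real.exp_add, ← Real.exp_nat_mul]
    congr 1
    rw [norm_sub_sq_real, norm_sub_sq_real, norm_smul, inner_smul_right, Real.norm_ofNat]
    push_cast
    ring
  have hc_le : c ≤ 1 + 4 * Real.pi * a ^ 2 := by
    have hpi := Real.pi_lt_d2
    have hx0 : 0 ≤ 2 * Real.pi * a ^ 2 := by positivity
    have hx1 : 2 * Real.pi * a ^ 2 ≤ 1 := by nlinarith [Real.pi_pos]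
    have := Real.abs_exp_sub_one_le (x := 2 * Real.pi * a ^ 2) (by rwa [abs_of_nonneg hx0])
    rw [abs_of_nonneg hx0] at this
    have := (abs_le.1 this).2
    linarith
  have j1 : Integrable fun v : V => (a / 2 + 1 / (2 * a)) * gaussianWeight v := hi.const_mul _
  have j2 : Integrable fun v : V => 1 / a * gaussianWeight (v - w) := hi1.const_mul _
  have j3 : Integrable fun v : V => c / (2 * a) * gaussianWeight (v - (2 : ℝ) • w) :=
    hi2.const_mul _
  have j12 : Integrable fun v : V => (a / 2 + 1 / (2 * a)) * gaussianWeight v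
      - 1 / a * gaussianWeight (v - w) := j1.sub j2
  calc ∫ v : V, |gaussianWeight v - gaussianWeight (v - w)|
      ≤ ∫ v : V, ((a / 2 + 1 / (2 * a)) * gaussianWeight v - 1 / a * gaussianWeight (v - w)
          + c / (2 * a) * gaussianWeight (v - (2 : ℝ) • w)) := by
        refine integral_mono (hi.sub hi1).abs (j12.add j3) fun v => ?_
        have h1 := gaussianWeight_pos v
        have hk := key v
        set p := gaussianWeight v
        set q := gaussianWeight (v - w)
        set z := gaussianWeight (v - (2 : ℝ) • w)
        have h2 : 2 * a * p * |p - q| ≤ a ^ 2 * p ^ 2 + (p - q) ^ 2 := by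
          nlinarith [sq_nonneg (a * p - |p - q|), sq_abs (p - q)]
        have h3 : 2 * a * p * |p - q| ≤
            2 * a * p * ((a / 2 + 1 / (2 * a)) * p - 1 / a * q + c / (2 * a) * z) := by
          have : 2 * a * p * ((a / 2 + 1 / (2 * a)) * p - 1 / a * q + c / (2 * a) * z)
              = a ^ 2 * p ^ 2 + p ^ 2 - 2 * p * q + p * (c * z) := by
            field_simp
          rw [this, ← hk]
          linarith
        exact le_of_mul_le_mul_left h3 (by positivity)
    _ = (a / 2 + 1 / (2 * a)) - 1 / a + c / (2 * a) := by
        rw [integral_add j12 j3, integral_sub j1 j2, integral_const_mul, integral_const_mul,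
          integral_const_mul, e1, e2, integral_gaussianWeight]
        ring
    _ ≤ (a / 2 + 1 / (2 * a)) - 1 / a + (1 + 4 * Real.pi * a ^ 2) / (2 * a) := by gcongr
    _ = (1 / 2 + 2 * Real.pi) * a := by field_simp; ring
    _ ≤ 7 * a := by
        have hpi := Real.pi_lt_d2
        gcongr
        linarith

variable (V) in
/-- The Gaussian probability measure with density `exp (-π ‖v‖ ^ 2)`. -/
noncomputable def gaussianKernel : Measure V :=
  volume.withDensity fun v => ENNReal.ofReal (gaussianWeight v)

instance : IsProbabilityMeasure (gaussianKernel V) := by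
  constructor
  rw [gaussianKernel, withDensity_apply _ MeasurableSet.univ, Measure.restrict_univ,
    ← ofReal_integral_eq_lintegral_ofReal integrable_gaussianWeight
      (ae_of_all _ fun v => (gaussianWeight_pos v).le), integral_gaussianWeight, ENNReal.ofReal_one]

lemma integral_gaussianKernel (h : V → ℝ) :
    ∫ v, h v ∂gaussianKernel V = ∫ v, gaussianWeight v * h v := by
  rw [gaussianKernel, integral_withDensity_eq_integral_toReal_smul
    measurable_ofReal_gaussianWeight (ae_of_all _ fun _ => ENNReal.ofReal_lt_top)]
  simp [ENNReal.toReal_ofReal (gaussianWeight_pos _).le]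

/-- A Chernoff bound, uniform over the directions `θ` and independent of the dimension. -/
lemma gaussianKernel_halfspace_le {θ : V} (hθ : ‖θ‖ = 1) (s : ℝ) :
    gaussianKernel V {v | s ≤ inner ℝ θ v} ≤ ENNReal.ofReal (Real.exp (1 - s)) := by
  set w : V := (1 / (2 * Real.pi)) • θ
  have hpi := Real.pi_gt_three
  have hw : ‖w‖ = 1 / (2 * Real.pi) := by
    rw [norm_smul, hθ, mul_one, Real.norm_of_nonneg (by positivity)]
  have hms : MeasurableSet {v : V | s ≤ inner ℝ θ v} :=
    (isClosed_le continuous_const (by fun_prop)).measurableSet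
  rw [gaussianKernel, withDensity_apply _ hms]
  calc ∫⁻ v in {v : V | s ≤ inner ℝ θ v}, ENNReal.ofReal (gaussianWeight v)
      ≤ ∫⁻ v in {v : V | s ≤ inner ℝ θ v},
          ENNReal.ofReal (Real.exp (1 - s)) * ENNReal.ofReal (gaussianWeight (v - w)) := by
        refine setLIntegral_mono' hms fun v hv => ?_
        rw [← ENNReal.ofReal_mul (Real.exp_pos _).le]
        refine ENNReal.ofReal_le_ofReal ?_
        rw [gaussianWeight, gaussianWeight, ← Real.exp_add]
        refine Real.exp_le_exp.2 ?_
        rw [norm_sub_sq_real, hw, inner_smul_right, real_inner_comm]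
        have e : -Real.pi * (‖v‖ ^ 2 - 2 * (1 / (2 * Real.pi) * inner ℝ θ v)
            + (1 / (2 * Real.pi)) ^ 2) = -Real.pi * ‖v‖ ^ 2 + inner ℝ θ v
              - 1 / (4 * Real.pi) := by
          field_simp
          ring
        have h1 : 1 / (4 * Real.pi) ≤ 1 := by
          rw [div_le_one (by positivity)]; linarith
        have hv' : s ≤ inner ℝ θ v := hv
        linarith
    _ ≤ ∫⁻ v, ENNReal.ofReal (Real.exp (1 - s)) * ENNReal.ofReal (gaussianWeight (v - w)) :=
        setLIntegral_le_lintegral _ _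
    _ = ENNReal.ofReal (Real.exp (1 - s)) := by
        rw [lintegral_const_mul' _ _ ENNReal.ofReal_ne_top,
          lintegral_sub_right_eq_self (fun v : V => ENNReal.ofReal (gaussianWeight v)),
          ← ofReal_integral_eq_lintegral_ofReal integrable_gaussianWeight
            (ae_of_all _ fun v => (gaussianWeight_pos v).le), integral_gaussianWeight,
          ENNReal.ofReal_one, mul_one]

/-- The Gaussian average at scale `t`: the expectation of `h (x + t G)`. -/
noncomputable def gaussianAverage (t : ℝ) (h : V → ℝ) (x : V) : ℝ :=
  ∫ v, h (x + t • v) ∂gaussianKernel V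

section average

variable {h : V → ℝ} {t : ℝ}

lemma gaussianAverage_nonneg (h0 : ∀ x, 0 ≤ h x) (x : V) : 0 ≤ gaussianAverage t h x :=
  integral_nonneg fun _ => h0 _

lemma gaussianAverage_le_one (h0 : ∀ x, 0 ≤ h x) (h1 : ∀ x, h x ≤ 1) (x : V) :
    gaussianAverage t h x ≤ 1 := by
  have := norm_integral_le_of_norm_le_const (μ := gaussianKernel V) (C := 1)
    (f := fun v => h (x + t • v))
    (ae_of_all _ fun v => by rw [Real.norm_of_nonneg (h0 _)]; exact h1 _)
  rw [gaussianAverage]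
  simpa using (le_abs_self _).trans this

/-- Gaussian averaging at scale `t` turns a function bounded by `1` into one with Lipschitz
constant of order `1 / t`, in any dimension. -/
lemma abs_gaussianAverage_sub_le (hm : Measurable h) (h0 : ∀ x, 0 ≤ h x) (h1 : ∀ x, h x ≤ 1)
    (ht : 0 < t) (x y : V) :
    |gaussianAverage t h x - gaussianAverage t h y| ≤ 7 / t * ‖x - y‖ := by
  set w : V := t⁻¹ • (y - x)
  have hi := integrable_gaussianWeight (V := V)
  have hi1 : Integrable (fun v : V => gaussianWeight (v - w)) := hi.comp_sub_right w
  have hb : ∀ v, ‖h (x + t • v)‖ ≤ 1 := fun v => by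
    rw [Real.norm_of_nonneg (h0 _)]; exact h1 _
  have hmx : Measurable fun v : V => h (x + t • v) := hm.comp (by fun_prop)
  have ey : gaussianAverage t h y = ∫ v, gaussianWeight (v - w) * h (x + t • v) := by
    rw [gaussianAverage, integral_gaussianKernel,
      ← integral_sub_right_eq_self (fun v : V => gaussianWeight v * h (y + t • v)) w]
    refine integral_congr_ae (ae_of_all _ fun v => ?_)
    have : y + t • (v - w) = x + t • v := by
      simp only [w, smul_sub, smul_inv_smul₀ ht.ne']
      abel
    simp only [this]
  have j1 : Integrable fun v => gaussianWeight v * h (x + t • v) :=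
    hi.mul_bdd hmx.aestronglyMeasurable (ae_of_all _ hb)
  have j2 : Integrable fun v => gaussianWeight (v - w) * h (x + t • v) :=
    hi1.mul_bdd hmx.aestronglyMeasurable (ae_of_all _ hb)
  rw [ey, gaussianAverage, integral_gaussianKernel, ← integral_sub j1 j2]
  calc |∫ v, (gaussianWeight v * h (x + t • v) - gaussianWeight (v - w) * h (x + t • v))|
      ≤ ∫ v, |gaussianWeight v * h (x + t • v) - gaussianWeight (v - w) * h (x + t • v)| :=
        abs_integral_le_integral_abs
    _ ≤ ∫ v, |gaussianWeight v - gaussianWeight (v - w)| := by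
        refine integral_mono (j1.sub j2).abs (hi.sub hi1).abs fun v => ?_
        simp only
        rw [← sub_mul, abs_mul]
        exact mul_le_of_le_one_right (abs_nonneg _) (hb v)
    _ ≤ 7 * ‖w‖ := integral_abs_gaussianWeight_sub_le w
    _ = 7 / t * ‖x - y‖ := by
        rw [norm_smul, norm_inv, Real.norm_of_nonneg ht.le, norm_sub_rev]
        ring

end average

end GaussianKernel

/-! ### Log-concave densities -/

section LogConcaveDensity

variable {V : Type*} [NormedAddCommGroup V] [InnerProductSpace ℝ V] [FiniteDimensional ℝ V]

/-- Strict separation of a point from a closed convex set by a unit normal. -/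
lemma exists_unit_inner_lt {S : Set V} (hS : Convex ℝ S) (hc : IsClosed S) (hne : S.Nonempty)
    {x : V} (hx : x ∉ S) : ∃ θ : V, ‖θ‖ = 1 ∧ ∀ y ∈ S, inner ℝ θ y < (inner ℝ θ x : ℝ) := by
  obtain ⟨L, u, h1, h2⟩ := geometric_hahn_banach_closed_point hS hc hx
  obtain ⟨y₀, hy₀⟩ := hne
  set w : V := (InnerProductSpace.toDual ℝ V).symm L
  have hw : ∀ y, inner ℝ w y = L y := fun y => InnerProductSpace.toDual_symm_apply
  have hw0 : w ≠ 0 := by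
    intro h
    have e1 := hw y₀
    have e2 := hw x
    have e3 := h1 y₀ hy₀
    rw [h, inner_zero_left] at e1 e2
    linarith
  have hn : 0 < ‖w‖ := norm_pos_iff.2 hw0
  refine ⟨‖w‖⁻¹ • w, by rw [norm_smul, norm_inv, norm_norm, inv_mul_cancel₀ hn.ne'], ?_⟩
  intro y hy
  rw [real_inner_smul_left, real_inner_smul_left, hw, hw]
  have := h1 y hy
  gcongr
  linarith

variable [MeasurableSpace V] [BorelSpace V]

/-- A bounded upper semicontinuous log-concave probability density. Log-concavity is stated
multiplicatively, so that `f` may vanish. -/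
structure IsLogConcaveDensity (f : V → ℝ) : Prop where
  nonneg : ∀ x, 0 ≤ f x
  rpow_mul_le : ∀ x y, ∀ l : ℝ, 0 < l → l < 1 →
    f x ^ l * f y ^ (1 - l) ≤ f (l • x + (1 - l) • y)
  isClosed_le : ∀ c, IsClosed {x | c ≤ f x}
  bddAbove : BddAbove (Set.range f)
  lintegral_eq_one : ∫⁻ x, ENNReal.ofReal (f x) = 1

lemma lintegral_comp_inv_smul_add {c : ℝ} (hc : 0 < c) (b : V) {g : V → ℝ≥0∞}
    (hg : Measurable g) : ∫⁻ x, g (c⁻¹ • x + b)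
      = ENNReal.ofReal (c ^ Module.finrank ℝ V) * ∫⁻ x, g x := by
  have h1 : Measurable fun x => g (x + b) := hg.comp (by fun_prop)
  rw [← lintegral_add_right_eq_self g b,
    ← lintegral_map (f := fun x => g (x + b)) (g := fun x : V => c⁻¹ • x) h1 (by fun_prop),
    Measure.map_addHaar_smul _ (inv_ne_zero hc.ne'), lintegral_smul_measure, inv_pow, inv_inv,
    abs_of_nonneg (by positivity), smul_eq_mul]

namespace IsLogConcaveDensity

variable {f : V → ℝ}

lemma measurable (hf : IsLogConcaveDensity f) : Measurable f :=
  measurable_of_Ici fun c => (hf.isClosed_le c).measurableSet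

lemma convex_le (hf : IsLogConcaveDensity f) {c : ℝ} (hc : 0 ≤ c) : Convex ℝ {x | c ≤ f x} := by
  refine convex_iff_forall_pos.2 fun x hx y hy p q hp hq hpq => ?_
  have hx' : c ≤ f x := hx
  have hy' : c ≤ f y := hy
  obtain rfl : q = 1 - p := by linarith
  refine le_trans ?_ (hf.rpow_mul_le x y p hp (by linarith))
  calc c = c ^ p * c ^ (1 - p) := by
        rw [← Real.rpow_add_of_nonneg hc hp.le hq.le]; simp
    _ ≤ f x ^ p * f y ^ (1 - p) := by
        have := hf.nonneg x
        gcongr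

/-- If every halfspace at distance `r` from the origin carries mass at least `c`, then `f` is
within a factor exponential in the dimension of its supremum on the ball of radius `r`. Indeed
`∫ √(f x * f y) dx ≤ 2 ^ d` bounds the mass of the sublevel set `{f < a}` by less than `c` for
a suitable level `a`, whereas a point of the ball where `f < a` could be separated from
`{a ≤ f}`, and a halfspace of mass at least `c` would lie in `{f < a}`. -/
lemma exists_le_on_ball (hf : IsLogConcaveDensity f) {r c : ℝ} (hc : 0 < c) (hc1 : c ≤ 1)
    (hmass : ∀ θ : V, ‖θ‖ = 1 →
      ENNReal.ofReal c ≤ ∫⁻ x in {x | r < inner ℝ θ x}, ENNReal.ofReal (f x)) :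
    ∃ a : ℝ, 0 < a ∧ (∀ x, ‖x‖ ≤ r → a ≤ f x) ∧
      ∀ x, f x ≤ 8 * 4 ^ Module.finrank ℝ V / c ^ 2 * a := by
  set d := Module.finrank ℝ V
  obtain ⟨y, hy, hmax⟩ : ∃ y, 0 < f y ∧ ∀ x, f x ≤ 2 * f y := by
    have hsup : 0 < sSup (Set.range f) := by
      by_contra! h
      have h0 : ∀ x, f x ≤ 0 := fun x => (le_csSup hf.bddAbove ⟨x, rfl⟩).trans h
      have := hf.lintegral_eq_one
      simp [ENNReal.ofReal_of_nonpos (h0 _)] at this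
    obtain ⟨_, ⟨y, rfl⟩, hy⟩ := exists_lt_of_lt_csSup (Set.range_nonempty f) (half_lt_self hsup)
    exact ⟨y, by linarith, fun x => (le_csSup hf.bddAbove ⟨x, rfl⟩).trans (by linarith)⟩
  set q : ℝ := c / (2 * 2 ^ d)
  have hq : 0 < q := by positivity
  have hq1 : q ≤ 1 := by
    rw [div_le_one (by positivity)]
    have : (1 : ℝ) ≤ 2 ^ d := one_le_pow₀ (by norm_num)
    linarith
  have hm := hf.measurable
  have hsqrt : ∫⁻ x, ENNReal.ofReal (√(f x * f y)) ≤ ENNReal.ofReal (2 ^ d) := by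
    calc ∫⁻ x, ENNReal.ofReal (√(f x * f y))
        ≤ ∫⁻ x, ENNReal.ofReal (f ((2 : ℝ)⁻¹ • x + (2 : ℝ)⁻¹ • y)) := by
          refine lintegral_mono fun x => ENNReal.ofReal_le_ofReal ?_
          have h := hf.rpow_mul_le x y 2⁻¹ (by norm_num) (by norm_num)
          rw [show (1 : ℝ) - 2⁻¹ = 2⁻¹ by norm_num,
            ← Real.mul_rpow (hf.nonneg x) (hf.nonneg y)] at h
          rwa [Real.sqrt_eq_rpow, one_div]
      _ = ENNReal.ofReal (2 ^ d) * ∫⁻ x, ENNReal.ofReal (f x) :=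
          lintegral_comp_inv_smul_add (by norm_num) _ hm.ennreal_ofReal
      _ = ENNReal.ofReal (2 ^ d) := by rw [hf.lintegral_eq_one, mul_one]
  set a : ℝ := q ^ 2 * f y
  have ha : 0 < a := by positivity
  have hma : MeasurableSet {x | f x < a} := measurableSet_lt hm measurable_const
  have hlow : ∫⁻ x in {x | f x < a}, ENNReal.ofReal (f x) ≤ ENNReal.ofReal (c / 2) := by
    calc ∫⁻ x in {x | f x < a}, ENNReal.ofReal (f x)
        ≤ ∫⁻ x in {x | f x < a}, ENNReal.ofReal q * ENNReal.ofReal (√(f x * f y)) := by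
          refine setLIntegral_mono' hma fun x hx => ?_
          rw [← ENNReal.ofReal_mul hq.le]
          refine ENNReal.ofReal_le_ofReal ?_
          have hx' : f x < q ^ 2 * f y := hx
          have h0 := hf.nonneg x
          refine abs_le_of_sq_le_sq' ?_ (by positivity) |>.2
          rw [mul_pow, Real.sq_sqrt (by positivity)]
          nlinarith
      _ ≤ ∫⁻ x, ENNReal.ofReal q * ENNReal.ofReal (√(f x * f y)) := setLIntegral_le_lintegral _ _
      _ ≤ ENNReal.ofReal q * ENNReal.ofReal (2 ^ d) := by
          rw [lintegral_const_mul' _ _ ENNReal.ofReal_ne_top]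
          gcongr
      _ = ENNReal.ofReal (c / 2) := by
          rw [← ENNReal.ofReal_mul hq.le]
          congr 1
          simp only [q]
          field_simp
  refine ⟨a, ha, fun x hx => ?_, fun x => ?_⟩
  · by_contra hxa
    have hay : a ≤ f y := mul_le_of_le_one_left hy.le (pow_le_one₀ hq.le hq1)
    obtain ⟨θ, hθ, hsep⟩ :=
      exists_unit_inner_lt (hf.convex_le ha.le) (hf.isClosed_le a) ⟨y, hay⟩ hxa
    have hsub : {z : V | r < inner ℝ θ z} ⊆ {z | f z < a} := fun z hz => by
      by_contra h
      have h1 := hsep z (not_lt.1 (by exact h) : a ≤ f z)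
      have h2 : inner ℝ θ x ≤ ‖θ‖ * ‖x‖ := real_inner_le_norm _ _
      have h3 : r < inner ℝ θ z := hz
      rw [hθ, one_mul] at h2
      linarith
    have := ((hmass θ hθ).trans (lintegral_mono_set hsub)).trans hlow
    rw [ENNReal.ofReal_le_ofReal_iff (by positivity)] at this
    linarith
  · refine (hmax x).trans (le_of_eq ?_)
    have h4 : (4 : ℝ) ^ d = 2 ^ d * 2 ^ d := by rw [← mul_pow]; norm_num
    simp only [a, q, h4]
    field_simp
    ring

end IsLogConcaveDensity

end LogConcaveDensity

/-! ### Displacement of a log-concave density by a Gaussian -/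

section Displacement

variable {V : Type*} [NormedAddCommGroup V] [InnerProductSpace ℝ V]

/-- The function `x ↦ f (x / (1 + s)) ^ (1 + s) * a ^ (-s)`. For a log-concave `f` that is at
least `a` on the ball of radius `r` it dominates `f`, and every point where it is less than `u` is
at distance at least `s * r` from the set `{u < f}`. -/
noncomputable def dilatedDensity (f : V → ℝ) (a s : ℝ) (x : V) : ℝ :=
  f ((1 + s)⁻¹ • x) ^ (1 + s) * a ^ (-s)

variable [FiniteDimensional ℝ V] [MeasurableSpace V] [BorelSpace V]

lemma lintegral_mul_exp_neg_Ioi {k : ℝ} (hk : 0 < k) (b : ℝ) :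
    ∫⁻ s in Set.Ioi b, ENNReal.ofReal (k * Real.exp (-k * s))
      = ENNReal.ofReal (Real.exp (-k * b)) := by
  rw [← ofReal_integral_eq_lintegral_ofReal
    ((integrableOn_exp_mul_Ioi (neg_lt_zero.2 hk) b).const_mul k)
    (ae_of_all _ fun s => by positivity), integral_const_mul,
    integral_exp_mul_Ioi (neg_lt_zero.2 hk)]
  congr 1
  field_simp

namespace IsLogConcaveDensity

variable {f : V → ℝ} {a r s t : ℝ}

lemma measurable_dilatedDensity (hf : IsLogConcaveDensity f) (a : ℝ) :
    Measurable fun p : ℝ × V => dilatedDensity f a p.1 p.2 := by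
  have := hf.measurable
  unfold dilatedDensity
  fun_prop

lemma le_dilatedDensity (hf : IsLogConcaveDensity f) (ha : 0 < a) (h0 : a ≤ f 0) (hs : 0 < s)
    (x : V) : f x ≤ dilatedDensity f a s x := by
  have h1 := hf.rpow_mul_le x 0 (1 + s)⁻¹ (by positivity) (inv_lt_one_of_one_lt₀ (by linarith))
  rw [smul_zero, add_zero] at h1
  have h2 := hf.nonneg x
  have e1 : (1 - (1 + s)⁻¹) * (1 + s) = s := by field_simp; ring
  have h3 : f x * a ^ s ≤ f ((1 + s)⁻¹ • x) ^ (1 + s) := by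
    calc f x * a ^ s = (f x ^ (1 + s)⁻¹ * a ^ (1 - (1 + s)⁻¹)) ^ (1 + s) := by
          rw [Real.mul_rpow (by positivity) (by positivity), ← Real.rpow_mul h2,
            ← Real.rpow_mul ha.le, e1, inv_mul_cancel₀ (by positivity), Real.rpow_one]
      _ ≤ _ := by
          refine Real.rpow_le_rpow (by positivity) (le_trans ?_ h1) (by positivity)
          have : 0 ≤ 1 - (1 + s)⁻¹ := by
            have := inv_le_one_of_one_le₀ (a := 1 + s) (by linarith)
            linarith
          gcongr
  rw [dilatedDensity, Real.rpow_neg ha.le, ← div_eq_mul_inv, le_div_iff₀ (by positivity)]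
  exact h3

lemma lintegral_dilatedDensity_le (hf : IsLogConcaveDensity f) (ha : 0 < a) {b : ℝ}
    (hb : ∀ x, f x ≤ b * a) (hb1 : 1 ≤ b) (hs : 0 < s) :
    ∫⁻ x, ENNReal.ofReal (dilatedDensity f a s x)
      ≤ ENNReal.ofReal (Real.exp ((Module.finrank ℝ V + Real.log b) * s)) := by
  have hm := hf.measurable
  have hb0 : 0 < b := by linarith
  calc ∫⁻ x, ENNReal.ofReal (dilatedDensity f a s x)
      = ENNReal.ofReal ((1 + s) ^ Module.finrank ℝ V)
          * ∫⁻ x, ENNReal.ofReal (f x ^ (1 + s) * a ^ (-s)) := by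
        have := lintegral_comp_inv_smul_add (V := V) (c := 1 + s) (by linarith) 0
          (g := fun x => ENNReal.ofReal (f x ^ (1 + s) * a ^ (-s))) (by fun_prop)
        simpa only [add_zero, dilatedDensity] using this
    _ ≤ ENNReal.ofReal (Real.exp (Module.finrank ℝ V * s))
          * ∫⁻ x, ENNReal.ofReal (Real.exp (Real.log b * s)) * ENNReal.ofReal (f x) := by
        refine mul_le_mul' (ENNReal.ofReal_le_ofReal ?_) (lintegral_mono fun x => ?_)
        · rw [mul_comm, Real.exp_mul, Real.rpow_natCast]
          gcongr
          linarith [Real.add_one_le_exp s]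
        · rw [← ENNReal.ofReal_mul (Real.exp_pos _).le]
          refine ENNReal.ofReal_le_ofReal ?_
          have h0 := hf.nonneg x
          rw [Real.exp_mul, Real.exp_log hb0, Real.rpow_neg ha.le, ← div_eq_mul_inv,
            div_le_iff₀ (by positivity), Real.rpow_add_of_nonneg h0 zero_le_one hs.le,
            Real.rpow_one]
          calc f x * f x ^ s ≤ f x * (b * a) ^ s := by
                have := hb x
                gcongr
            _ = b ^ s * f x * a ^ s := by rw [Real.mul_rpow hb0.le ha.le]; ring
    _ = _ := by
        rw [lintegral_const_mul' _ _ ENNReal.ofReal_ne_top, hf.lintegral_eq_one, mul_one,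
          ← ENNReal.ofReal_mul (Real.exp_pos _).le, ← Real.exp_add, add_mul]

/-- If `dilatedDensity f a s x < u`, then `x / (1 + s)` lies outside a closed convex superlevel
set that contains the convex combinations of `{u < f}` and the ball of radius `r`. A separating
hyperplane shows that `{u < f}` is beyond a hyperplane at distance `s * r` from `x`. -/
lemma gaussianKernel_lt_le (hf : IsLogConcaveDensity f) (ha : 0 < a) (hr : 0 < r)
    (hball : ∀ x, ‖x‖ ≤ r → a ≤ f x) (hs : 0 < s) (ht : 0 < t) {u : ℝ} (hu : 0 < u) {x : V}
    (hx : dilatedDensity f a s x < u) :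
    gaussianKernel V {v | u < f (x + t • v)} ≤ ENNReal.ofReal (Real.exp (1 - r / t * s)) := by
  rcases Set.eq_empty_or_nonempty {z | u < f z} with he | ⟨z₀, hz₀⟩
  · have : {v | u < f (x + t • v)} = ∅ := by
      ext v
      simpa using fun h => Set.eq_empty_iff_forall_notMem.1 he (x + t • v) h
    simp [this]
  set l : ℝ := (1 + s)⁻¹ with hl
  have hl0 : 0 < l := by positivity
  have hl1 : l < 1 := inv_lt_one_of_one_lt₀ (by linarith)
  have hls : l * (1 + s) = 1 := inv_mul_cancel₀ (by positivity)
  set c : ℝ := u ^ l * a ^ (1 - l)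
  have hc0 : 0 < c := by positivity
  have hxc : l • x ∉ {y | c ≤ f y} := by
    intro h
    have h : c ≤ f (l • x) := h
    have h1 : c ^ (1 + s) ≤ f (l • x) ^ (1 + s) := Real.rpow_le_rpow hc0.le h (by linarith)
    have e1 : (1 - l) * (1 + s) = s := by linarith
    rw [Real.mul_rpow (by positivity) (by positivity), ← Real.rpow_mul hu.le,
      ← Real.rpow_mul ha.le, e1, hls, Real.rpow_one] at h1
    rw [dilatedDensity, Real.rpow_neg ha.le, ← div_eq_mul_inv, div_lt_iff₀ (by positivity)] at hx
    linarith
  have hmem : ∀ z b : V, u < f z → ‖b‖ ≤ r → l • z + (1 - l) • b ∈ {y | c ≤ f y} := by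
    intro z b hz hb
    refine le_trans ?_ (hf.rpow_mul_le z b l hl0 hl1)
    have := hball b hb
    have := hf.nonneg z
    have : 0 ≤ 1 - l := by linarith
    simp only [c]
    gcongr
  obtain ⟨θ, hθ, hsep⟩ := exists_unit_inner_lt (hf.convex_le hc0.le) (hf.isClosed_le c)
    ⟨_, hmem z₀ 0 hz₀ (by simpa using hr.le)⟩ hxc
  refine le_trans (measure_mono fun v hv => ?_)
    (gaussianKernel_halfspace_le (θ := -θ) (by rwa [norm_neg]) (r / t * s))
  have h1 := hsep _ (hmem (x + t • v) (r • θ) hv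
    (by rw [norm_smul, hθ, mul_one, Real.norm_of_nonneg hr.le]))
  rw [inner_add_right, inner_smul_right, inner_smul_right, inner_add_right, inner_smul_right,
    inner_smul_right, inner_smul_right, real_inner_self_eq_norm_sq, hθ] at h1
  have h2 : l * (t * inner ℝ θ v + s * r) < 0 := by
    have : l * s = 1 - l := by linarith
    linear_combination h1 + r * this
  have h3 : t * inner ℝ θ v + s * r < 0 := by
    by_contra! h
    have := mul_nonneg hl0.le h
    linarith
  show r / t * s ≤ inner ℝ (-θ) v
  rw [inner_neg_left, div_mul_eq_mul_div, div_le_iff₀ ht]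
  linarith

/-- The previous bound rewritten as an average over `s` of the indicators of
`{u ≤ dilatedDensity f a s x}`, a form that can be integrated in `u` and `x`. If the left side is
`exp (1 - r / t * b)`, then `u ≤ dilatedDensity f a s x` for every `s > b`. -/
lemma gaussianKernel_lt_le_lintegral (hf : IsLogConcaveDensity f) (ha : 0 < a) (hr : 0 < r)
    (hball : ∀ x, ‖x‖ ≤ r → a ≤ f x) (ht : 0 < t) {u : ℝ} (hu : 0 < u) (x : V) :
    gaussianKernel V {v | u < f (x + t • v)} ≤ ENNReal.ofReal (Real.exp 1) *
      ∫⁻ s in Set.Ioi 0, ENNReal.ofReal (r / t * Real.exp (-(r / t) * s)) *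
        {s | u ≤ dilatedDensity f a s x}.indicator 1 s := by
  set k := r / t
  have hk : 0 < k := by positivity
  set A := gaussianKernel V {v | u < f (x + t • v)} with hA
  have hA1 : A ≤ 1 := prob_le_one
  have hAtop : A ≠ ∞ := ne_top_of_le_ne_top ENNReal.one_ne_top hA1
  rcases eq_or_ne A 0 with h0 | h0
  · simp [h0]
  set m : ℝ := A.toReal / Real.exp 1
  have hA0 : 0 < A.toReal := ENNReal.toReal_pos h0 hAtop
  have hm : 0 < m := by positivity
  have hm1 : m ≤ 1 := by
    rw [div_le_one (Real.exp_pos _)]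
    have : A.toReal ≤ 1 := ENNReal.toReal_le_of_le_ofReal zero_le_one (by simpa using hA1)
    linarith [Real.add_one_le_exp 1]
  set b : ℝ := -Real.log m / k
  have hb : 0 ≤ b := div_nonneg (neg_nonneg.2 (Real.log_nonpos hm.le hm1)) hk.le
  have hbm : Real.exp (-k * b) = m := by
    have : -k * b = Real.log m := by simp only [b]; field_simp
    rw [this, Real.exp_log hm]
  have hbig : ∀ s, b < s → u ≤ dilatedDensity f a s x := by
    intro s hs
    by_contra! h
    have h1 := hf.gaussianKernel_lt_le ha hr hball (hb.trans_lt hs) ht hu h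
    have h2 : A.toReal ≤ Real.exp (1 - k * s) :=
      ENNReal.toReal_le_of_le_ofReal (Real.exp_pos _).le h1
    have h3 : Real.exp (1 - k * s) < Real.exp (1 - k * b) := Real.exp_lt_exp.2 (by nlinarith)
    have h4 : Real.exp (1 - k * b) = A.toReal := by
      rw [show 1 - k * b = 1 + -k * b by ring, Real.exp_add, hbm]
      simp only [m]
      field_simp
    linarith
  calc A = ENNReal.ofReal (Real.exp 1) * ENNReal.ofReal m := by
        rw [← ENNReal.ofReal_mul (Real.exp_pos _).le,
          show Real.exp 1 * m = A.toReal by simp only [m]; field_simp, ENNReal.ofReal_toReal hAtop]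
    _ = ENNReal.ofReal (Real.exp 1)
          * ∫⁻ s in Set.Ioi b, ENNReal.ofReal (k * Real.exp (-k * s)) := by
        rw [lintegral_mul_exp_neg_Ioi hk, hbm]
    _ = ENNReal.ofReal (Real.exp 1) * ∫⁻ s in Set.Ioi b, ENNReal.ofReal (k * Real.exp (-k * s)) *
        {s | u ≤ dilatedDensity f a s x}.indicator 1 s := by
        congr 1
        refine setLIntegral_congr_fun measurableSet_Ioi fun s hs => ?_
        rw [Set.indicator_of_mem (show s ∈ {s | u ≤ dilatedDensity f a s x} from hbig s hs),
          Pi.one_apply, mul_one]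
    _ ≤ _ := by
        gcongr

/-- A pointwise form of the displacement estimate: the mean positive increment of `f` at `x` under
a Gaussian step is controlled by exponential averages of the increments of the dilations. -/
lemma lintegral_increment_le (hf : IsLogConcaveDensity f) (ha : 0 < a) (hr : 0 < r)
    (hball : ∀ x, ‖x‖ ≤ r → a ≤ f x) (ht : 0 < t) (x : V) :
    ∫⁻ v, ENNReal.ofReal (f (x + t • v) - f x) ∂gaussianKernel V ≤ ENNReal.ofReal (Real.exp 1) *
      ∫⁻ s in Set.Ioi 0, ENNReal.ofReal (r / t * Real.exp (-(r / t) * s)) *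
        ENNReal.ofReal (dilatedDensity f a s x - f x) := by
  have hm := hf.measurable
  have hΦ : Measurable fun s : ℝ => dilatedDensity f a s x :=
    (hf.measurable_dilatedDensity a).comp (by fun_prop : Measurable fun s : ℝ => (s, x))
  have hmax : Measurable fun v : V => max (f (x + t • v) - f x) 0 := by fun_prop
  calc ∫⁻ v, ENNReal.ofReal (f (x + t • v) - f x) ∂gaussianKernel V
      = ∫⁻ v, ENNReal.ofReal (max (f (x + t • v) - f x) 0) ∂gaussianKernel V := by
        refine lintegral_congr fun v => ?_
        rw [ENNReal.ofReal_max, ENNReal.ofReal_zero, max_eq_left zero_le]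
    _ = ∫⁻ w in Set.Ioi (0 : ℝ), gaussianKernel V {v | w < max (f (x + t • v) - f x) 0} :=
        lintegral_eq_lintegral_meas_lt _ (ae_of_all _ fun v => le_max_right _ _) hmax.aemeasurable
    _ ≤ ∫⁻ w in Set.Ioi (0 : ℝ), ENNReal.ofReal (Real.exp 1) *
          ∫⁻ s in Set.Ioi 0, ENNReal.ofReal (r / t * Real.exp (-(r / t) * s)) *
            {p : ℝ × ℝ | f x + p.1 ≤ dilatedDensity f a p.2 x}.indicator 1 (w, s) := by
        refine setLIntegral_mono' measurableSet_Ioi fun w hw => ?_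
        have hw : 0 < w := hw
        have hset : {v | w < max (f (x + t • v) - f x) 0} = {v | f x + w < f (x + t • v)} := by
          ext v
          simp only [Set.mem_ofPred_eq, lt_max_iff, hw.not_gt, or_false]
          exact lt_sub_iff_add_lt'
        rw [hset]
        exact hf.gaussianKernel_lt_le_lintegral ha hr hball ht
          (add_pos_of_nonneg_of_pos (hf.nonneg x) hw) x
    _ = ENNReal.ofReal (Real.exp 1) * ∫⁻ s in Set.Ioi 0, ∫⁻ w in Set.Ioi (0 : ℝ),
          ENNReal.ofReal (r / t * Real.exp (-(r / t) * s)) *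
            {p : ℝ × ℝ | f x + p.1 ≤ dilatedDensity f a p.2 x}.indicator 1 (w, s) := by
        rw [lintegral_const_mul' _ _ ENNReal.ofReal_ne_top, lintegral_lintegral_swap]
        refine Measurable.aemeasurable (Measurable.mul (by fun_prop) ?_)
        refine measurable_one.indicator (measurableSet_le (by fun_prop) (by fun_prop))
    _ ≤ _ := by
        gcongr with s
        rw [lintegral_const_mul' _ _ ENNReal.ofReal_ne_top]
        gcongr
        calc ∫⁻ w in Set.Ioi (0 : ℝ),
              {p : ℝ × ℝ | f x + p.1 ≤ dilatedDensity f a p.2 x}.indicator 1 (w, s)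
            = ∫⁻ w in Set.Ioi (0 : ℝ), (Set.Iic (dilatedDensity f a s x - f x)).indicator 1 w := by
              refine lintegral_congr fun w => ?_
              simp only [Set.indicator, Set.mem_ofPred_eq, Set.mem_Iic, le_sub_iff_add_le',
                Pi.one_apply]
          _ = volume (Set.Ioc 0 (dilatedDensity f a s x - f x)) := by
              rw [lintegral_indicator_one measurableSet_Iic,
                Measure.restrict_apply measurableSet_Iic, Set.inter_comm, Set.Ioi_inter_Iic]
          _ ≤ _ := by rw [Real.volume_Ioc, sub_zero]

/-- The displacement estimate: a Gaussian step of size `t` moves at most a mass of order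
`(d + log b) * t / r` of a log-concave density that is at least `a` on the ball of radius `r` and
at most `b * a` everywhere. -/
lemma lintegral_lintegral_increment_le (hf : IsLogConcaveDensity f) (ha : 0 < a) (hr : 0 < r)
    (hball : ∀ x, ‖x‖ ≤ r → a ≤ f x) {b : ℝ} (hb : ∀ x, f x ≤ b * a) (ht : 0 < t)
    (hsmall : 2 * (Module.finrank ℝ V + Real.log b) ≤ r / t) :
    ∫⁻ x, ∫⁻ v, ENNReal.ofReal (f (x + t • v) - f x) ∂gaussianKernel V ≤
      ENNReal.ofReal (Real.exp 1 * (2 * (Module.finrank ℝ V + Real.log b) / (r / t))) := by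
  have hm := hf.measurable
  have hΦ := hf.measurable_dilatedDensity a
  set k := r / t
  have hk : 0 < k := by positivity
  have hb1 : 1 ≤ b := by
    have := (hball 0 (by simpa using hr.le)).trans (hb 0)
    nlinarith
  set K : ℝ := Module.finrank ℝ V + Real.log b
  have hK : 0 ≤ K := add_nonneg (Nat.cast_nonneg _) (Real.log_nonneg hb1)
  have hnum : k / (k - K) - 1 ≤ 2 * K / k := by
    have : 0 < k - K := by linarith
    rw [div_sub_one this.ne', div_le_div_iff₀ this hk]
    nlinarith
  have hdil : ∀ s ∈ Set.Ioi (0 : ℝ), ∫⁻ x, ENNReal.ofReal (dilatedDensity f a s x - f x)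
      ≤ ENNReal.ofReal (Real.exp (K * s) - 1) := by
    intro s hs
    have hms : Measurable fun x : V => dilatedDensity f a s x :=
      hΦ.comp (by fun_prop : Measurable fun x : V => (s, x))
    calc ∫⁻ x, ENNReal.ofReal (dilatedDensity f a s x - f x)
        = ∫⁻ x, (ENNReal.ofReal (dilatedDensity f a s x) - ENNReal.ofReal (f x)) :=
          lintegral_congr fun x =>
            ENNReal.ofReal_sub (dilatedDensity f a s x) (hf.nonneg x)
      _ = (∫⁻ x, ENNReal.ofReal (dilatedDensity f a s x)) - ∫⁻ x, ENNReal.ofReal (f x) := by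
          refine lintegral_sub hm.ennreal_ofReal (by simp [hf.lintegral_eq_one])
            (ae_of_all _ fun x => ENNReal.ofReal_le_ofReal ?_)
          exact hf.le_dilatedDensity ha (hball 0 (by simpa using hr.le)) hs x
      _ ≤ _ := by
          rw [hf.lintegral_eq_one, ENNReal.ofReal_sub _ zero_le_one, ENNReal.ofReal_one]
          exact tsub_le_tsub_right (hf.lintegral_dilatedDensity_le ha hb hb1 hs) _
  calc ∫⁻ x, ∫⁻ v, ENNReal.ofReal (f (x + t • v) - f x) ∂gaussianKernel V
      ≤ ∫⁻ x, ENNReal.ofReal (Real.exp 1) *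
          ∫⁻ s in Set.Ioi 0, ENNReal.ofReal (k * Real.exp (-k * s)) *
            ENNReal.ofReal (dilatedDensity f a s x - f x) :=
        lintegral_mono fun x => hf.lintegral_increment_le ha hr hball ht x
    _ = ENNReal.ofReal (Real.exp 1) * ∫⁻ s in Set.Ioi 0,
          ENNReal.ofReal (k * Real.exp (-k * s)) *
            ∫⁻ x, ENNReal.ofReal (dilatedDensity f a s x - f x) := by
        rw [lintegral_const_mul' _ _ ENNReal.ofReal_ne_top, lintegral_lintegral_swap]
        · simp only [lintegral_const_mul' _ _ ENNReal.ofReal_ne_top]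
        · have : Measurable fun p : V × ℝ => dilatedDensity f a p.2 p.1 :=
            hΦ.comp measurable_swap
          exact Measurable.aemeasurable (by fun_prop)
    _ ≤ ENNReal.ofReal (Real.exp 1) * ∫⁻ s in Set.Ioi 0,
          ENNReal.ofReal (k * Real.exp (-k * s)) * ENNReal.ofReal (Real.exp (K * s) - 1) := by
        refine mul_le_mul' le_rfl ?_
        refine setLIntegral_mono' measurableSet_Ioi fun s hs => ?_
        gcongr
        exact hdil s hs
    _ = ENNReal.ofReal (Real.exp 1) * ENNReal.ofReal (k / (k - K) - 1) := by
        congr 1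
        have i1 : IntegrableOn (fun s => k * Real.exp (-(k - K) * s)) (Set.Ioi 0) :=
          (integrableOn_exp_mul_Ioi (by linarith) 0).const_mul k
        have i2 : IntegrableOn (fun s => k * Real.exp (-k * s)) (Set.Ioi 0) :=
          (integrableOn_exp_mul_Ioi (by linarith) 0).const_mul k
        have i3 : IntegrableOn
            (fun s => k * Real.exp (-(k - K) * s) - k * Real.exp (-k * s)) (Set.Ioi 0) := i1.sub i2
        have e : ∀ s : ℝ, k * Real.exp (-k * s) * (Real.exp (K * s) - 1)
            = k * Real.exp (-(k - K) * s) - k * Real.exp (-k * s) := fun s => by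
          rw [mul_sub, mul_one, mul_assoc, ← Real.exp_add]
          ring_nf
        have hval : ∫ s in Set.Ioi (0 : ℝ), (k * Real.exp (-(k - K) * s) - k * Real.exp (-k * s))
            = k / (k - K) - 1 := by
          rw [integral_sub i1 i2, integral_const_mul, integral_const_mul,
            integral_exp_mul_Ioi (by linarith), integral_exp_mul_Ioi (by linarith)]
          have : k - K ≠ 0 := by linarith
          simp only [mul_zero, Real.exp_zero]
          rw [neg_div_neg_eq, neg_div_neg_eq]
          field_simp
        rw [← hval, ofReal_integral_eq_lintegral_ofReal i3]
        · refine lintegral_congr fun s => ?_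
          rw [← ENNReal.ofReal_mul (by positivity), e]
        · refine (ae_restrict_iff' measurableSet_Ioi).2 (ae_of_all _ fun s hs => ?_)
          have hs : 0 < s := hs
          simp only [Pi.zero_apply, ← e]
          have : 1 ≤ Real.exp (K * s) := Real.one_le_exp (by positivity)
          exact mul_nonneg (by positivity) (by linarith)
    _ ≤ _ := by
        rw [← ENNReal.ofReal_mul (Real.exp_pos _).le]
        gcongr

/-- Averaging a test function `h` with values in `[0, 1]` over Gaussian steps of size `t` loses
little mass against a log-concave density. -/
lemma lintegral_mul_le_lintegral_gaussianAverage (hf : IsLogConcaveDensity f) (ha : 0 < a)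
    (hr : 0 < r) (hball : ∀ x, ‖x‖ ≤ r → a ≤ f x) {b : ℝ} (hb : ∀ x, f x ≤ b * a) (ht : 0 < t)
    {h : V → ℝ} (hm : Measurable h) (h0 : ∀ x, 0 ≤ h x) (h1 : ∀ x, h x ≤ 1) :
    ∫⁻ x, ENNReal.ofReal (h x) * ENNReal.ofReal (f x) ≤
      (∫⁻ x, ENNReal.ofReal (gaussianAverage t h x) * ENNReal.ofReal (f x)) +
      ENNReal.ofReal (Real.exp 1 * (2 * (Module.finrank ℝ V + Real.log b) / (r / t))) := by
  have hfm := hf.measurable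
  have hle : ∀ x, ENNReal.ofReal (h x) ≤ 1 := fun x => by simpa using h1 x
  rcases le_or_gt (2 * (Module.finrank ℝ V + Real.log b)) (r / t) with hsmall | hbig
  · calc ∫⁻ x, ENNReal.ofReal (h x) * ENNReal.ofReal (f x)
        = ∫⁻ v, (∫⁻ x, ENNReal.ofReal (h (x + t • v)) * ENNReal.ofReal (f (x + t • v)))
            ∂gaussianKernel V := by
          refine Eq.symm ((lintegral_congr fun v => lintegral_add_right_eq_self (μ := volume)
            (fun x : V => ENNReal.ofReal (h x) * ENNReal.ofReal (f x)) (t • v)).trans ?_)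
          rw [lintegral_const, measure_univ, mul_one]
      _ ≤ ∫⁻ v, (∫⁻ x, (ENNReal.ofReal (h (x + t • v)) * ENNReal.ofReal (f x)
            + ENNReal.ofReal (f (x + t • v) - f x))) ∂gaussianKernel V := by
          refine lintegral_mono fun v => lintegral_mono fun x => ?_
          calc ENNReal.ofReal (h (x + t • v)) * ENNReal.ofReal (f (x + t • v))
              ≤ ENNReal.ofReal (h (x + t • v)) * (ENNReal.ofReal (f x)
                + ENNReal.ofReal (f (x + t • v) - f x)) := by
                gcongr
                rw [← tsub_le_iff_left, ENNReal.ofReal_sub _ (hf.nonneg x)]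
            _ ≤ _ := by
                rw [mul_add]
                gcongr
                exact mul_le_of_le_one_left zero_le (hle _)
      _ = (∫⁻ x, ∫⁻ v, ENNReal.ofReal (h (x + t • v)) * ENNReal.ofReal (f x) ∂gaussianKernel V)
            + ∫⁻ x, ∫⁻ v, ENNReal.ofReal (f (x + t • v) - f x) ∂gaussianKernel V := by
          rw [lintegral_lintegral_swap (Measurable.aemeasurable (by fun_prop)),
            ← lintegral_add_left]
          · refine lintegral_congr fun x => lintegral_add_left ?_ _
            have : Measurable fun v => h (x + t • v) := hm.comp (by fun_prop)
            exact this.ennreal_ofReal.mul_const _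
          · exact Measurable.lintegral_prod_right'
              (f := fun p : V × V => ENNReal.ofReal (h (p.1 + t • p.2)) * ENNReal.ofReal (f p.1))
              (by fun_prop)
      _ ≤ _ := by
          refine add_le_add (le_of_eq (lintegral_congr fun x => ?_))
            (hf.lintegral_lintegral_increment_le ha hr hball hb ht hsmall)
          rw [lintegral_mul_const' _ _ ENNReal.ofReal_ne_top, gaussianAverage,
            ofReal_integral_eq_lintegral_ofReal _ (ae_of_all _ fun _ => h0 _)]
          refine Integrable.of_bound
            (by fun_prop : Measurable fun v => h (x + t • v)).aestronglyMeasurable 1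
            (ae_of_all _ fun v => ?_)
          rw [Real.norm_of_nonneg (h0 _)]
          exact h1 _
  · -- for large steps the error term exceeds the total mass
    refine le_add_left ?_
    calc ∫⁻ x, ENNReal.ofReal (h x) * ENNReal.ofReal (f x) ≤ ∫⁻ x, ENNReal.ofReal (f x) :=
          lintegral_mono fun x => mul_le_of_le_one_left zero_le (hle _)
      _ = ENNReal.ofReal 1 := by rw [hf.lintegral_eq_one, ENNReal.ofReal_one]
      _ ≤ _ := by
          refine ENNReal.ofReal_le_ofReal ?_
          have h2 : 1 ≤ 2 * (Module.finrank ℝ V + Real.log b) / (r / t) := by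
            rw [le_div_iff₀ (by positivity)]; linarith
          nlinarith [Real.add_one_le_exp 1]

end IsLogConcaveDensity

end Displacement

/-! ### Tails of isotropic log-concave measures -/

section Tails

variable {n : ℕ} {μ : Measure (EuclideanSpace ℝ (Fin n))}

/-- The defining inequality of log-concavity extends from compact to measurable sets by inner
regularity; passing to a superset `C` of the Minkowski combination avoids its measurability. -/
lemma IsLogConcaveMeasure.rpow_mul_rpow_le [IsFiniteMeasure μ] (hμ : IsLogConcaveMeasure μ)
    {A B C : Set (EuclideanSpace ℝ (Fin n))} (hA : MeasurableSet A) (hB : MeasurableSet B)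
    {l : ℝ} (hl0 : 0 < l) (hl1 : l < 1)
    (hC : ∀ x ∈ A, ∀ y ∈ B, l • x + (1 - l) • y ∈ C) : μ A ^ l * μ B ^ (1 - l) ≤ μ C := by
  have hl1' : 0 < 1 - l := by linarith
  refine ENNReal.mul_le_of_forall_lt fun p hp q hq => ?_
  have hp' : p ^ l⁻¹ < μ A := by
    have := ENNReal.rpow_lt_rpow hp (inv_pos.2 hl0)
    rwa [← ENNReal.rpow_mul, mul_inv_cancel₀ hl0.ne', ENNReal.rpow_one] at this
  have hq' : q ^ (1 - l)⁻¹ < μ B := by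
    have := ENNReal.rpow_lt_rpow hq (inv_pos.2 hl1')
    rwa [← ENNReal.rpow_mul, mul_inv_cancel₀ hl1'.ne', ENNReal.rpow_one] at this
  obtain ⟨K, hKA, hK, hpK⟩ := hA.exists_lt_isCompact hp'
  obtain ⟨L, hLB, hL, hqL⟩ := hB.exists_lt_isCompact hq'
  have hKne : K.Nonempty := nonempty_of_measure_ne_zero (μ := μ) (ne_bot_of_gt hpK)
  have hLne : L.Nonempty := nonempty_of_measure_ne_zero (μ := μ) (ne_bot_of_gt hqL)
  calc p * q = (p ^ l⁻¹) ^ l * (q ^ (1 - l)⁻¹) ^ (1 - l) := by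
        rw [ENNReal.rpow_inv_rpow hl0.ne', ENNReal.rpow_inv_rpow hl1'.ne']
    _ ≤ μ K ^ l * μ L ^ (1 - l) := by gcongr
    _ ≤ μ (l • K + (1 - l) • L) := hμ K L hK hL hKne hLne l hl0 hl1
    _ ≤ μ C := by
        refine measure_mono ?_
        rintro _ ⟨_, ⟨x, hx, rfl⟩, _, ⟨y, hy, rfl⟩, rfl⟩
        exact hC x (hKA hx) y (hLB hy)

lemma IsIsotropicMeasure.memLp_inner (hμ : IsIsotropicMeasure μ)
    (θ : EuclideanSpace ℝ (Fin n)) : MemLp (fun x => inner ℝ θ x) 2 μ :=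
  hμ.memLp_two.const_inner θ

lemma IsIsotropicMeasure.integral_inner [IsFiniteMeasure μ] (hμ : IsIsotropicMeasure μ)
    (θ : EuclideanSpace ℝ (Fin n)) : ∫ x, inner ℝ θ x ∂μ = 0 := by
  rw [_root_.integral_inner (hμ.memLp_two.integrable one_le_two), hμ.mean_eq_zero, inner_zero_right]

lemma IsIsotropicMeasure.integral_inner_sq (hμ : IsIsotropicMeasure μ)
    (θ : EuclideanSpace ℝ (Fin n)) : ∫ x, inner ℝ θ x ^ 2 ∂μ = ‖θ‖ ^ 2 := by
  have hcoord : ∀ i, MemLp (fun x : EuclideanSpace ℝ (Fin n) => x i) 2 μ := fun i => by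
    simpa [EuclideanSpace.inner_single_left] using
      hμ.memLp_inner (EuclideanSpace.single i (1 : ℝ))
  have hint : ∀ i j, Integrable (fun x : EuclideanSpace ℝ (Fin n) => x i * x j) μ :=
    fun i j => (hcoord i).integrable_mul (hcoord j)
  have e : ∀ x : EuclideanSpace ℝ (Fin n),
      inner ℝ θ x ^ 2 = ∑ i, ∑ j, θ i * θ j * (x i * x j) := fun x => by
    rw [PiLp.inner_apply, sq, Finset.sum_mul_sum]
    refine Finset.sum_congr rfl fun i _ => Finset.sum_congr rfl fun j _ => ?_
    simp only [RCLike.inner_apply, conj_trivial]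
    ring
  simp only [e]
  rw [integral_finsetSum _ fun i _ => integrable_finsetSum _ fun j _ => (hint i j).const_mul _]
  simp only [integral_finsetSum _ fun j _ => (hint _ j).const_mul _, integral_const_mul,
    hμ.second_moment, Matrix.one_apply, mul_ite, mul_one, mul_zero, Finset.sum_ite_eq,
    Finset.mem_univ, if_true]
  rw [EuclideanSpace.norm_sq_eq]
  refine Finset.sum_congr rfl fun i _ => ?_
  rw [Real.norm_eq_abs, sq_abs, sq]

/-- Exponential decay of one-dimensional marginals (Borell's lemma for the slab of half-width `2`,
which has mass at least `3 / 4` by Chebyshev's inequality). -/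
lemma measure_lt_abs_inner_le [IsProbabilityMeasure μ] (hlc : IsLogConcaveMeasure μ)
    (hiso : IsIsotropicMeasure μ) {θ : EuclideanSpace ℝ (Fin n)} (hθ : ‖θ‖ = 1) (s : ℝ) :
    μ {x | s < |inner ℝ θ x|} ≤ ENNReal.ofReal (Real.exp (1 - s / 4)) := by
  rcases le_or_gt s 2 with hs | hs
  · refine prob_le_one.trans ?_
    rw [ENNReal.one_le_ofReal]
    exact Real.one_le_exp (by linarith)
  have hmeas : ∀ b : ℝ, MeasurableSet {x : EuclideanSpace ℝ (Fin n) | b < |inner ℝ θ x|} :=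
    fun b => (isOpen_lt continuous_const (by fun_prop)).measurableSet
  set p := μ.real {x | 2 < |inner ℝ θ x|} with hp
  have hp4 : p ≤ 1 / 4 := by
    have h := mul_meas_ge_le_integral_of_nonneg (μ := μ) (f := fun x => inner ℝ θ x ^ 2)
      (ae_of_all _ fun x => sq_nonneg _) (hiso.memLp_inner θ).integrable_sq 4
    rw [hiso.integral_inner_sq, hθ] at h
    have hsub : p ≤ μ.real {x | 4 ≤ inner ℝ θ x ^ 2} := by
      refine measureReal_mono fun x hx => ?_
      have hx : 2 < |inner ℝ θ x| := hx
      show (4 : ℝ) ≤ inner ℝ θ x ^ 2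
      rw [← sq_abs]
      nlinarith
    linarith
  -- this weight sends `|⟪θ, x⟫| > s` and `|⟪θ, y⟫| ≤ 2` to a combination beyond `2`
  set l : ℝ := 4 / (s + 2) with hl
  have hl0 : 0 < l := by positivity
  have hl1 : l < 1 := by rw [hl, div_lt_one (by linarith)]; linarith
  have hls : l * (s + 2) = 4 := by rw [hl]; field_simp
  set N := μ.real {x | s < |inner ℝ θ x|} with hN
  have hN0 : 0 ≤ N := measureReal_nonneg
  have hborell : N ^ l * (1 - p) ^ (1 - l) ≤ p := by
    have h := hlc.rpow_mul_rpow_le (hmeas s) (hmeas 2).compl (C := {x | 2 < |inner ℝ θ x|})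
      hl0 hl1 fun x hx y hy => by
        have hx : s < |inner ℝ θ x| := hx
        have hy : |inner ℝ θ y| ≤ 2 := not_lt.1 hy
        show 2 < |inner ℝ θ (l • x + (1 - l) • y)|
        rw [inner_add_right, inner_smul_right, inner_smul_right]
        have h1 := abs_sub_abs_le_abs_sub (l * inner ℝ θ x) (-((1 - l) * inner ℝ θ y))
        rw [sub_neg_eq_add, abs_neg, abs_mul, abs_mul, abs_of_pos hl0,
          abs_of_pos (by linarith : 0 < 1 - l)] at h1
        nlinarith
    have h2 := ENNReal.toReal_mono (measure_ne_top _ _) h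
    rw [ENNReal.toReal_mul, ← ENNReal.toReal_rpow, ← ENNReal.toReal_rpow] at h2
    rwa [← measureReal_def, ← measureReal_def, ← measureReal_def,
      probReal_compl_eq_one_sub (hmeas 2)] at h2
  -- otherwise the left side of `hborell` exceeds `3 / (4 * e) > 1 / 4 ≥ p`
  have hNle : N ≤ Real.exp (1 - s / 4) := by
    by_contra! h
    have h1 : Real.exp (-1) ≤ N ^ l := by
      calc Real.exp (-1) ≤ Real.exp ((1 - s / 4) * l) := by
            refine Real.exp_le_exp.2 ?_
            nlinarith
        _ = Real.exp (1 - s / 4) ^ l := Real.exp_mul _ _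
        _ ≤ N ^ l := by gcongr
    have h2 : 3 / 4 ≤ (1 - p) ^ (1 - l) := by
      calc (3 : ℝ) / 4 = (3 / 4) ^ (1 : ℝ) := (Real.rpow_one _).symm
        _ ≤ (3 / 4) ^ (1 - l) :=
            Real.rpow_le_rpow_of_exponent_ge (by norm_num) (by norm_num) (by linarith)
        _ ≤ (1 - p) ^ (1 - l) :=
            Real.rpow_le_rpow (by norm_num) (by linarith) (by linarith)
    have h3 : (0.36 : ℝ) < Real.exp (-1) := by
      have := Real.exp_neg_one_gt_d9
      linarith
    nlinarith
  rw [← ofReal_measureReal]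
  exact ENNReal.ofReal_le_ofReal hNle

lemma lintegral_abs_inner_rpow_three_le [IsProbabilityMeasure μ] (hlc : IsLogConcaveMeasure μ)
    (hiso : IsIsotropicMeasure μ) {θ : EuclideanSpace ℝ (Fin n)} (hθ : ‖θ‖ = 1) :
    ∫⁻ x, ENNReal.ofReal (|inner ℝ θ x| ^ (3 : ℝ)) ∂μ ≤ ENNReal.ofReal 1200 := by
  have hval : ∫ s in Set.Ioi (0 : ℝ), s ^ ((3 : ℝ) - 1) * Real.exp (-(1 / 4 * s)) = 128 := by
    rw [Real.integral_rpow_mul_exp_neg_mul_Ioi (by norm_num) (by norm_num),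
      show (3 : ℝ) = (2 : ℕ) + 1 by norm_num, Real.Gamma_nat_eq_factorial,
      ← Nat.cast_add_one, Real.rpow_natCast]
    norm_num [Nat.factorial]
  have hint : IntegrableOn (fun s : ℝ => s ^ ((3 : ℝ) - 1) * Real.exp (-(1 / 4 * s)))
      (Set.Ioi 0) := by
    by_contra h
    rw [integral_undef h] at hval
    norm_num at hval
  rw [lintegral_rpow_eq_lintegral_meas_lt_mul μ (ae_of_all _ fun x => abs_nonneg _)
    (by fun_prop) (by norm_num)]
  calc ENNReal.ofReal 3 * ∫⁻ s in Set.Ioi (0 : ℝ),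
        μ {x | s < |inner ℝ θ x|} * ENNReal.ofReal (s ^ ((3 : ℝ) - 1))
      ≤ ENNReal.ofReal 3 * ∫⁻ s in Set.Ioi (0 : ℝ), ENNReal.ofReal (Real.exp 1) *
          ENNReal.ofReal (s ^ ((3 : ℝ) - 1) * Real.exp (-(1 / 4 * s))) := by
        refine mul_le_mul' le_rfl (lintegral_mono fun s => ?_)
        refine (mul_le_mul' (measure_lt_abs_inner_le hlc hiso hθ s) le_rfl).trans (le_of_eq ?_)
        rw [← ENNReal.ofReal_mul (Real.exp_pos _).le, ← ENNReal.ofReal_mul (Real.exp_pos _).le,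
          show 1 - s / 4 = 1 + -(1 / 4 * s) by ring, Real.exp_add]
        congr 1
        ring
    _ = ENNReal.ofReal (3 * (Real.exp 1 * 128)) := by
        rw [lintegral_const_mul' _ _ ENNReal.ofReal_ne_top,
          ← ofReal_integral_eq_lintegral_ofReal hint
            ((ae_restrict_iff' measurableSet_Ioi).2 (ae_of_all _ fun s hs => ?_)), hval,
          ← ENNReal.ofReal_mul (Real.exp_pos _).le, ← ENNReal.ofReal_mul (by norm_num)]
        have : 0 < s := hs
        exact mul_nonneg (by positivity) (Real.exp_pos _).le
    _ ≤ ENNReal.ofReal 1200 := by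
        refine ENNReal.ofReal_le_ofReal ?_
        have := Real.exp_one_lt_d9
        linarith

/-- Halfspaces at a small distance from the origin carry a mass bounded below by an absolute
constant. The bound on third moments turns the unit variance of a marginal into a lower bound for
its first absolute moment (through `z ^ 2 ≤ L * |z| + |z| ^ 3 / L` with `L = 2400`), half of which
comes from the positive part as the mean is zero; finally `z⁺ ≤ η + η * z ^ 2 + 1_{z > η} / (4 * η)`
with `η = 1 / 40000`. -/
lemma le_measure_lt_inner [IsProbabilityMeasure μ] (hlc : IsLogConcaveMeasure μ)
    (hiso : IsIsotropicMeasure μ) {θ : EuclideanSpace ℝ (Fin n)} (hθ : ‖θ‖ = 1) :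
    ENNReal.ofReal (1 / 10 ^ 9) ≤ μ {x | 1 / 40000 < inner ℝ θ x} := by
  have i1 : Integrable (fun x => inner ℝ θ x) μ := (hiso.memLp_inner θ).integrable one_le_two
  have i2 : Integrable (fun x => inner ℝ θ x ^ 2) μ := (hiso.memLp_inner θ).integrable_sq
  have h3 := lintegral_abs_inner_rpow_three_le hlc hiso hθ
  have hm3 : AEStronglyMeasurable (fun x => |inner ℝ θ x| ^ (3 : ℝ)) μ :=
    Measurable.aestronglyMeasurable (by fun_prop)
  have hn3 : 0 ≤ᵐ[μ] fun x => |inner ℝ θ x| ^ (3 : ℝ) :=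
    ae_of_all _ fun x => Real.rpow_nonneg (abs_nonneg _) _
  have i3 : Integrable (fun x => |inner ℝ θ x| ^ (3 : ℝ)) μ :=
    ⟨hm3, (hasFiniteIntegral_iff_ofReal hn3).2 (h3.trans_lt ENNReal.ofReal_lt_top)⟩
  have v3 : ∫ x, |inner ℝ θ x| ^ (3 : ℝ) ∂μ ≤ 1200 := by
    rw [integral_eq_lintegral_of_nonneg_ae hn3 hm3]
    exact ENNReal.toReal_le_of_le_ofReal (by norm_num) h3
  have v2 := hiso.integral_inner_sq θ
  have v1 := hiso.integral_inner θ
  rw [hθ] at v2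
  have habs : 1 ≤ 2400 * ∫ x, |inner ℝ θ x| ∂μ + 1 / 2 := by
    calc (1 : ℝ) = ∫ x, inner ℝ θ x ^ 2 ∂μ := by rw [v2]; norm_num
      _ ≤ ∫ x, (2400 * |inner ℝ θ x| + 1 / 2400 * |inner ℝ θ x| ^ (3 : ℝ)) ∂μ := by
          refine integral_mono i2 ((i1.abs.const_mul _).add (i3.const_mul _)) fun x => ?_
          have h0 := abs_nonneg (inner ℝ θ x)
          simp only
          rw [← sq_abs, show (3 : ℝ) = (3 : ℕ) by norm_num, Real.rpow_natCast]
          set z := |(inner ℝ θ x : ℝ)|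
          rcases le_or_gt z 2400 with hz | hz
          · have : 0 ≤ z ^ 3 := by positivity
            nlinarith
          · have : 0 ≤ z ^ 2 * (z - 2400) := mul_nonneg (sq_nonneg z) (by linarith)
            nlinarith
      _ ≤ _ := by
          rw [integral_add (i1.abs.const_mul _) (i3.const_mul _), integral_const_mul,
            integral_const_mul]
          linarith
  set S := {x : EuclideanSpace ℝ (Fin n) | 1 / 40000 < inner ℝ θ x} with hS
  have hSm : MeasurableSet S := (isOpen_lt continuous_const (by fun_prop)).measurableSet
  have iS : Integrable (S.indicator fun _ => (1 : ℝ)) μ := (integrable_const 1).indicator hSm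
  have hpos : ∫ x, (|inner ℝ θ x| + inner ℝ θ x) / 2 ∂μ
      ≤ 1 / 40000 + 1 / 40000 * 1 + 10000 * μ.real S := by
    calc ∫ x, (|inner ℝ θ x| + inner ℝ θ x) / 2 ∂μ
        ≤ ∫ x, (1 / 40000 + 1 / 40000 * inner ℝ θ x ^ 2
            + 10000 * S.indicator (fun _ => (1 : ℝ)) x) ∂μ := by
          refine integral_mono ((i1.abs.add i1).div_const 2)
            (((integrable_const _).add (i2.const_mul _)).add (iS.const_mul _)) fun x => ?_
          simp only
          by_cases hx : x ∈ S
          · have hx' : 1 / 40000 < (inner ℝ θ x : ℝ) := hx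
            rw [Set.indicator_of_mem hx, abs_of_pos (by linarith)]
            nlinarith [sq_nonneg ((inner ℝ θ x : ℝ) - 20000)]
          · have hx' : (inner ℝ θ x : ℝ) ≤ 1 / 40000 := not_lt.1 hx
            rw [Set.indicator_of_notMem hx]
            have := sq_nonneg (inner ℝ θ x : ℝ)
            rcases abs_cases (inner ℝ θ x : ℝ) with h | h <;> rw [h.1] <;> linarith
      _ = _ := by
          have j1 : Integrable (fun x => 1 / 40000 + 1 / 40000 * inner ℝ θ x ^ 2) μ :=
            (integrable_const _).add (i2.const_mul _)
          rw [integral_add j1 (iS.const_mul _), integral_add (integrable_const _) (i2.const_mul _),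
            integral_const_mul, integral_const_mul, v2, integral_indicator_const _ hSm]
          simp
  have hsplit : ∫ x, (|inner ℝ θ x| + inner ℝ θ x) / 2 ∂μ = (∫ x, |inner ℝ θ x| ∂μ) / 2 := by
    rw [integral_div, integral_add i1.abs i1, v1, add_zero]
  rw [← ofReal_measureReal]
  refine ENNReal.ofReal_le_ofReal ?_
  rw [hsplit] at hpos
  linarith

end Tails

/-! ### Averaging a measure over small balls -/

section BallDensity

variable {n : ℕ} {μ : Measure (EuclideanSpace ℝ (Fin n))} {ε : ℝ}

/-- The density of the convolution of `μ` with the uniform distribution on the ball of radius `ε`.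
For a log-concave `μ` it is log-concave without any appeal to the existence of a density of `μ`. -/
noncomputable def ballDensity (μ : Measure (EuclideanSpace ℝ (Fin n))) (ε : ℝ)
    (x : EuclideanSpace ℝ (Fin n)) : ℝ :=
  μ.real (Metric.closedBall x ε) /
    volume.real (Metric.closedBall (0 : EuclideanSpace ℝ (Fin n)) ε)

lemma volumeReal_closedBall_pos (hε : 0 < ε) :
    0 < volume.real (Metric.closedBall (0 : EuclideanSpace ℝ (Fin n)) ε) :=
  ENNReal.toReal_pos (Metric.measure_closedBall_pos volume _ hε).ne' measure_closedBall_lt_top.ne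

lemma isClosed_le_measureReal_closedBall [IsFiniteMeasure μ] (hε : 0 < ε) (c : ℝ) :
    IsClosed {x | c ≤ μ.real (Metric.closedBall x ε)} := by
  refine isClosed_of_closure_subset fun x hx => ?_
  have htend : Filter.Tendsto (fun δ => μ (Metric.cthickening δ (Metric.closedBall x ε)))
      (nhdsWithin 0 (Set.Ioi 0)) (nhds (μ (Metric.closedBall x ε))) :=
    (tendsto_measure_cthickening_of_isClosed ⟨1, one_pos, measure_ne_top _ _⟩
      Metric.isClosed_closedBall).mono_left nhdsWithin_le_nhds
  have hreal := (ENNReal.tendsto_toReal (measure_ne_top μ (Metric.closedBall x ε))).comp htend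
  refine ge_of_tendsto hreal ?_
  filter_upwards [self_mem_nhdsWithin] with δ hδ
  have hδ : 0 < δ := hδ
  obtain ⟨y, hy, hxy⟩ := Metric.mem_closure_iff.1 hx δ hδ
  have hy : c ≤ μ.real (Metric.closedBall y ε) := hy
  refine hy.trans (measureReal_mono ?_)
  rw [cthickening_closedBall hδ.le hε.le]
  refine Metric.closedBall_subset_closedBall' ?_
  rw [dist_comm]
  linarith

/-- Integrating against `ballDensity μ ε` is integrating averages over balls against `μ`. -/
lemma lintegral_mul_ballDensity [IsFiniteMeasure μ] (hε : 0 < ε)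
    {g : EuclideanSpace ℝ (Fin n) → ℝ≥0∞} (hg : Measurable g) :
    ∫⁻ x, g x * ENNReal.ofReal (ballDensity μ ε x) =
      ∫⁻ z, (∫⁻ x in Metric.closedBall z ε, g x) *
        (volume (Metric.closedBall (0 : EuclideanSpace ℝ (Fin n)) ε))⁻¹ ∂μ := by
  set v := volume (Metric.closedBall (0 : EuclideanSpace ℝ (Fin n)) ε) with hv
  have hv0 : v ≠ 0 := (Metric.measure_closedBall_pos volume _ hε).ne'
  have hD : MeasurableSet
      {p : EuclideanSpace ℝ (Fin n) × EuclideanSpace ℝ (Fin n) | dist p.1 p.2 ≤ ε} :=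
    (isClosed_le (by fun_prop) continuous_const).measurableSet
  calc ∫⁻ x, g x * ENNReal.ofReal (ballDensity μ ε x)
      = ∫⁻ x, ∫⁻ z, {p : EuclideanSpace ℝ (Fin n) × EuclideanSpace ℝ (Fin n) |
          dist p.1 p.2 ≤ ε}.indicator (fun p => g p.1) (x, z) * v⁻¹ ∂μ := by
        refine lintegral_congr fun x => ?_
        have h1 : (fun z => {p : EuclideanSpace ℝ (Fin n) × EuclideanSpace ℝ (Fin n) |
            dist p.1 p.2 ≤ ε}.indicator (fun p => g p.1) (x, z))
            = (Metric.closedBall x ε).indicator fun _ => g x := by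
          ext z
          simp only [Set.indicator, Set.mem_ofPred_eq, Metric.mem_closedBall, dist_comm]
        rw [lintegral_mul_const' _ _ (ENNReal.inv_ne_top.2 hv0), h1,
          lintegral_indicator_const measurableSet_closedBall, ballDensity, measureReal_def,
          measureReal_def, ← hv,
          ENNReal.ofReal_div_of_pos (ENNReal.toReal_pos hv0 measure_closedBall_lt_top.ne),
          ENNReal.ofReal_toReal (measure_ne_top _ _),
          ENNReal.ofReal_toReal measure_closedBall_lt_top.ne, div_eq_mul_inv, mul_assoc]
    _ = ∫⁻ z, (∫⁻ x, {p : EuclideanSpace ℝ (Fin n) × EuclideanSpace ℝ (Fin n) |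
          dist p.1 p.2 ≤ ε}.indicator (fun p => g p.1) (x, z) * v⁻¹) ∂μ := by
        refine lintegral_lintegral_swap (Measurable.aemeasurable ?_)
        exact ((hg.comp measurable_fst).indicator hD).mul_const _
    _ = _ := by
        refine lintegral_congr fun z => ?_
        have h1 : (fun x => {p : EuclideanSpace ℝ (Fin n) × EuclideanSpace ℝ (Fin n) |
            dist p.1 p.2 ≤ ε}.indicator (fun p => g p.1) (x, z))
            = (Metric.closedBall z ε).indicator g := by
          ext x
          simp only [Set.indicator, Set.mem_ofPred_eq, Metric.mem_closedBall]
        rw [lintegral_mul_const' _ _ (ENNReal.inv_ne_top.2 hv0), h1,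
          lintegral_indicator measurableSet_closedBall]

lemma lintegral_le_lintegral_mul_ballDensity [IsFiniteMeasure μ] (hε : 0 < ε)
    {g G : EuclideanSpace ℝ (Fin n) → ℝ≥0∞} (hg : Measurable g)
    (h : ∀ x z, dist x z ≤ ε → G z ≤ g x) :
    ∫⁻ z, G z ∂μ ≤ ∫⁻ x, g x * ENNReal.ofReal (ballDensity μ ε x) := by
  rw [lintegral_mul_ballDensity hε hg]
  refine lintegral_mono fun z => ?_
  have h1 : G z * volume (Metric.closedBall z ε) ≤ ∫⁻ x in Metric.closedBall z ε, g x := by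
    rw [← setLIntegral_const]
    exact setLIntegral_mono hg fun x hx => h x z hx
  rw [Measure.addHaar_closedBall_center] at h1
  calc G z = G z * volume (Metric.closedBall (0 : EuclideanSpace ℝ (Fin n)) ε) *
        (volume (Metric.closedBall (0 : EuclideanSpace ℝ (Fin n)) ε))⁻¹ := by
        rw [mul_assoc, ENNReal.mul_inv_cancel (Metric.measure_closedBall_pos volume _ hε).ne'
          measure_closedBall_lt_top.ne, mul_one]
    _ ≤ _ := by gcongr

lemma lintegral_mul_ballDensity_le_lintegral [IsFiniteMeasure μ] (hε : 0 < ε)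
    {g G : EuclideanSpace ℝ (Fin n) → ℝ≥0∞} (hg : Measurable g)
    (h : ∀ x z, dist x z ≤ ε → g x ≤ G z) :
    ∫⁻ x, g x * ENNReal.ofReal (ballDensity μ ε x) ≤ ∫⁻ z, G z ∂μ := by
  rw [lintegral_mul_ballDensity hε hg]
  refine lintegral_mono fun z => ?_
  have h1 : ∫⁻ x in Metric.closedBall z ε, g x ≤ G z * volume (Metric.closedBall z ε) := by
    rw [← setLIntegral_const]
    exact setLIntegral_mono' measurableSet_closedBall fun x hx => h x z hx
  rw [Measure.addHaar_closedBall_center] at h1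
  calc _ ≤ G z * volume (Metric.closedBall (0 : EuclideanSpace ℝ (Fin n)) ε) *
        (volume (Metric.closedBall (0 : EuclideanSpace ℝ (Fin n)) ε))⁻¹ := by gcongr
    _ = G z := by
        rw [mul_assoc, ENNReal.mul_inv_cancel (Metric.measure_closedBall_pos volume _ hε).ne'
          measure_closedBall_lt_top.ne, mul_one]

lemma isLogConcaveDensity_ballDensity [IsProbabilityMeasure μ] (hμ : IsLogConcaveMeasure μ)
    (hε : 0 < ε) : IsLogConcaveDensity (ballDensity μ ε) where
  nonneg x := div_nonneg measureReal_nonneg measureReal_nonneg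
  rpow_mul_le x y l hl0 hl1 := by
    have hv := volumeReal_closedBall_pos (n := n) hε
    have h := hμ.rpow_mul_rpow_le (A := Metric.closedBall x ε) (B := Metric.closedBall y ε)
      (C := Metric.closedBall (l • x + (1 - l) • y) ε) measurableSet_closedBall
      measurableSet_closedBall hl0 hl1 fun p hp q hq => by
        rw [Metric.mem_closedBall, dist_eq_norm] at hp hq ⊢
        have hl1' : 0 < 1 - l := by linarith
        calc ‖l • p + (1 - l) • q - (l • x + (1 - l) • y)‖
            = ‖l • (p - x) + (1 - l) • (q - y)‖ := by
              congr 1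
              rw [smul_sub, smul_sub]
              abel
          _ ≤ l * ‖p - x‖ + (1 - l) * ‖q - y‖ := by
              refine (norm_add_le _ _).trans (le_of_eq ?_)
              rw [norm_smul, norm_smul, Real.norm_of_nonneg hl0.le, Real.norm_of_nonneg hl1'.le]
          _ ≤ l * ε + (1 - l) * ε := by gcongr
          _ = ε := by ring
    have h2 := ENNReal.toReal_mono (measure_ne_top _ _) h
    rw [ENNReal.toReal_mul, ← ENNReal.toReal_rpow, ← ENNReal.toReal_rpow, ← measureReal_def,
      ← measureReal_def, ← measureReal_def] at h2
    simp only [ballDensity]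
    rw [Real.div_rpow measureReal_nonneg hv.le, Real.div_rpow measureReal_nonneg hv.le,
      div_mul_div_comm, ← Real.rpow_add hv, add_sub_cancel, Real.rpow_one]
    gcongr
  isClosed_le c := by
    simp only [ballDensity, le_div_iff₀ (volumeReal_closedBall_pos (n := n) hε)]
    exact isClosed_le_measureReal_closedBall hε _
  bddAbove := by
    refine ⟨1 / volume.real (Metric.closedBall (0 : EuclideanSpace ℝ (Fin n)) ε), ?_⟩
    rintro _ ⟨x, rfl⟩
    have : μ.real (Metric.closedBall x ε) ≤ 1 := measureReal_le_one
    unfold ballDensity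
    gcongr
  lintegral_eq_one := by
    have h1 := lintegral_le_lintegral_mul_ballDensity (μ := μ) hε (g := 1) (G := 1)
      measurable_one fun _ _ _ => le_rfl
    have h2 := lintegral_mul_ballDensity_le_lintegral (μ := μ) hε (g := 1) (G := 1)
      measurable_one fun _ _ _ => le_rfl
    simp only [Pi.one_apply, one_mul, lintegral_const, measure_univ] at h1 h2
    exact le_antisymm h2 h1

end BallDensity

/-! ### Gaussian averaging against an isotropic log-concave measure -/

section Smoothing

variable {n : ℕ} {μ : Measure (EuclideanSpace ℝ (Fin n))}

lemma integrable_of_nonneg_of_le_one [IsFiniteMeasure μ] {h : EuclideanSpace ℝ (Fin n) → ℝ}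
    (hm : Measurable h) (h0 : ∀ x, 0 ≤ h x) (h1 : ∀ x, h x ≤ 1) : Integrable h μ :=
  Integrable.of_bound hm.aestronglyMeasurable 1 (ae_of_all _ fun x => by
    rw [Real.norm_of_nonneg (h0 x)]; exact h1 x)

/-- The constant in `integral_le_integral_gaussianAverage_add`: for `n ≥ 1` and after
multiplication by `n * t` it bounds the error in
`IsLogConcaveDensity.lintegral_mul_le_lintegral_gaussianAverage` for balls of radius `1 / 80000`
and the ratio `8 * 4 ^ n / c ^ 2` of `IsLogConcaveDensity.exists_le_on_ball` with `c = 1 / 10 ^ 9`. -/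
noncomputable def smoothingConstant : ℝ :=
  Real.exp 1 * (2 * (1 + Real.log (8 / (1 / 10 ^ 9) ^ 2) + Real.log 4) / (1 / 80000))

lemma smoothingConstant_pos : 0 < smoothingConstant := by
  have h1 : 0 < Real.log (8 / (1 / 10 ^ 9) ^ 2) := Real.log_pos (by norm_num)
  have h2 : 0 < Real.log 4 := Real.log_pos (by norm_num)
  unfold smoothingConstant
  positivity

/-- Averaging a test function over Gaussian steps of size `t` changes its integral against an
isotropic log-concave probability measure by at most a constant times `n * t`. The displacement
estimate is applied to the averages of `μ` over balls of radius `ε`, whose effect on Lipschitz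
functions vanishes as `ε → 0`. -/
lemma integral_le_integral_gaussianAverage_add [IsProbabilityMeasure μ] (hn : 1 ≤ n)
    (hlc : IsLogConcaveMeasure μ) (hiso : IsIsotropicMeasure μ) {t : ℝ} (ht : 0 < t)
    {h : EuclideanSpace ℝ (Fin n) → ℝ} {K : NNReal} (hK : LipschitzWith K h)
    (h0 : ∀ x, 0 ≤ h x) (h1 : ∀ x, h x ≤ 1) :
    ∫ x, h x ∂μ ≤ ∫ x, gaussianAverage t h x ∂μ + smoothingConstant * (n * t) := by
  have hm : Measurable h := hK.continuous.measurable
  set P := gaussianAverage t h with hP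
  have hP0 : ∀ x, 0 ≤ P x := gaussianAverage_nonneg h0
  have hP1 : ∀ x, P x ≤ 1 := gaussianAverage_le_one h0 h1
  have hPlip : ∀ x y, |P x - P y| ≤ 7 / t * ‖x - y‖ := abs_gaussianAverage_sub_le hm h0 h1 ht
  have hPm : Measurable P := by
    have : LipschitzWith (7 / t).toNNReal P := LipschitzWith.of_dist_le_mul fun x y => by
      rw [Real.dist_eq, dist_eq_norm, Real.coe_toNNReal _ (by positivity)]
      exact hPlip x y
    exact this.continuous.measurable
  have hsc := smoothingConstant_pos
  have key : ∀ ε : ℝ, 0 < ε → ε ≤ 1 / 80000 →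
      ∫ x, h x ∂μ ≤ ∫ x, P x ∂μ + smoothingConstant * (n * t) + (K + 7 / t) * ε := by
    intro ε hε hεr
    have hf := isLogConcaveDensity_ballDensity hlc hε
    have hfm := hf.measurable
    obtain ⟨a, ha, hball, hb⟩ := hf.exists_le_on_ball (r := 1 / 80000) (c := 1 / 10 ^ 9)
      (by norm_num) (by norm_num) fun θ hθ => by
        have hSm : MeasurableSet {x : EuclideanSpace ℝ (Fin n) | 1 / 80000 < inner ℝ θ x} :=
          (isOpen_lt continuous_const (by fun_prop)).measurableSet
        have hSm' : MeasurableSet {x : EuclideanSpace ℝ (Fin n) | 1 / 40000 < inner ℝ θ x} :=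
          (isOpen_lt continuous_const (by fun_prop)).measurableSet
        -- averaging over balls of radius `ε ≤ 1 / 80000` moves the halfspace by at most `ε`
        refine (le_measure_lt_inner hlc hiso hθ).trans ?_
        rw [← lintegral_indicator_one hSm', ← lintegral_indicator hSm]
        refine (lintegral_le_lintegral_mul_ballDensity hε
          (g := {x : EuclideanSpace ℝ (Fin n) | 1 / 80000 < inner ℝ θ x}.indicator 1)
          (measurable_one.indicator hSm) fun x z hxz => ?_).trans (le_of_eq ?_)
        · by_cases hz : z ∈ {x : EuclideanSpace ℝ (Fin n) | 1 / 40000 < inner ℝ θ x}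
          · have hz' : 1 / 40000 < (inner ℝ θ z : ℝ) := hz
            have h2 : (inner ℝ θ (z - x) : ℝ) ≤ ‖θ‖ * ‖z - x‖ := real_inner_le_norm _ _
            rw [hθ, one_mul, ← dist_eq_norm, dist_comm, inner_sub_right] at h2
            have hx : x ∈ {x : EuclideanSpace ℝ (Fin n) | 1 / 80000 < inner ℝ θ x} := by
              show (1 / 80000 : ℝ) < inner ℝ θ x
              linarith
            rw [Set.indicator_of_mem hz, Set.indicator_of_mem hx]
            exact le_rfl
          · rw [Set.indicator_of_notMem hz]
            exact zero_le
        · refine lintegral_congr fun x => ?_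
          simp only [Set.indicator]
          split_ifs <;> simp
    set b : ℝ := 8 * 4 ^ Module.finrank ℝ (EuclideanSpace ℝ (Fin n)) / (1 / 10 ^ 9) ^ 2
    have hmain := hf.lintegral_mul_le_lintegral_gaussianAverage ha (by norm_num) hball hb ht
      hm h0 h1
    have herr : Real.exp 1 * (2 * (Module.finrank ℝ (EuclideanSpace ℝ (Fin n)) + Real.log b)
        / (1 / 80000 / t)) ≤ smoothingConstant * (n * t) := by
      have hn' : (1 : ℝ) ≤ n := by exact_mod_cast hn
      have hlog : Real.log b = Real.log (8 / (1 / 10 ^ 9) ^ 2) + n * Real.log 4 := by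
        simp only [b, finrank_euclideanSpace_fin]
        rw [mul_div_right_comm, Real.log_mul (by positivity) (by positivity), Real.log_pow]
      have hL : 0 < Real.log (8 / (1 / 10 ^ 9) ^ 2) := Real.log_pos (by norm_num)
      rw [hlog, finrank_euclideanSpace_fin, smoothingConstant]
      set L := Real.log (8 / (1 / 10 ^ 9) ^ 2)
      calc _ = Real.exp 1 * (2 * (n + (L + n * Real.log 4)) / (1 / 80000)) * t := by
            field_simp
        _ ≤ Real.exp 1 * (2 * (n + (n * L + n * Real.log 4)) / (1 / 80000)) * t := by
            gcongr
            nlinarith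
        _ = _ := by ring
    have s1 : ∫⁻ x, ENNReal.ofReal (h x) ∂μ ≤
        (∫⁻ x, ENNReal.ofReal (h x) * ENNReal.ofReal (ballDensity μ ε x))
          + ENNReal.ofReal (K * ε) := by
      refine (lintegral_le_lintegral_mul_ballDensity hε
        (g := fun x => ENNReal.ofReal (h x) + ENNReal.ofReal (K * ε)) (by fun_prop)
        fun x z hxz => ?_).trans (le_of_eq ?_)
      · rw [← ENNReal.ofReal_add (h0 x) (by positivity)]
        refine ENNReal.ofReal_le_ofReal ?_
        have h2 := hK.dist_le_mul z x
        rw [Real.dist_eq, dist_comm] at h2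
        have h3 : (K : ℝ) * dist x z ≤ K * ε := by gcongr
        linarith [le_abs_self (h z - h x)]
      · simp only [add_mul]
        rw [lintegral_add_left (by fun_prop), lintegral_const_mul' _ _ ENNReal.ofReal_ne_top,
          hf.lintegral_eq_one, mul_one]
    have s2 : ∫⁻ x, ENNReal.ofReal (P x) * ENNReal.ofReal (ballDensity μ ε x) ≤
        (∫⁻ x, ENNReal.ofReal (P x) ∂μ) + ENNReal.ofReal (7 / t * ε) := by
      refine (lintegral_mul_ballDensity_le_lintegral hε
        (G := fun x => ENNReal.ofReal (P x) + ENNReal.ofReal (7 / t * ε)) (by fun_prop)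
        fun x z hxz => ?_).trans (le_of_eq ?_)
      · rw [← ENNReal.ofReal_add (hP0 z) (by positivity)]
        refine ENNReal.ofReal_le_ofReal ?_
        have h2 := hPlip x z
        rw [← dist_eq_norm] at h2
        have h3 : 7 / t * dist x z ≤ 7 / t * ε := by gcongr
        linarith [le_abs_self (P x - P z)]
      · rw [lintegral_add_left (by fun_prop), lintegral_const, measure_univ, mul_one]
    rw [← ofReal_integral_eq_lintegral_ofReal (integrable_of_nonneg_of_le_one hm h0 h1)
      (ae_of_all _ h0)] at s1
    rw [← ofReal_integral_eq_lintegral_ofReal (integrable_of_nonneg_of_le_one hPm hP0 hP1)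
      (ae_of_all _ hP0)] at s2
    have hPi : 0 ≤ ∫ x, P x ∂μ := integral_nonneg hP0
    have htot : ENNReal.ofReal (∫ x, h x ∂μ) ≤ ENNReal.ofReal
        (∫ x, P x ∂μ + 7 / t * ε + smoothingConstant * (n * t) + K * ε) := by
      rw [ENNReal.ofReal_add (by positivity) (by positivity),
        ENNReal.ofReal_add (by positivity) (by positivity),
        ENNReal.ofReal_add (by positivity) (by positivity)]
      refine s1.trans ?_
      gcongr
      refine hmain.trans ?_
      gcongr
    have := (ENNReal.ofReal_le_ofReal_iff (by positivity)).1 htot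
    linarith
  refine le_of_forall_pos_le_add fun η hη => ?_
  have hc : 0 < (K : ℝ) + 7 / t := by positivity
  refine (key (min (1 / 80000) (η / (K + 7 / t))) (by positivity) (min_le_left _ _)).trans ?_
  have : (K + 7 / t) * min (1 / 80000) (η / (K + 7 / t)) ≤ η := by
    calc (K + 7 / t) * min (1 / 80000) (η / (K + 7 / t))
        ≤ (K + 7 / t) * (η / (K + 7 / t)) := by gcongr; exact min_le_right _ _
      _ = η := by field_simp
  linarith

end Smoothing

/-! ### Total variation and bounded Lipschitz distances -/

section Distances

variable {n : ℕ} {μ ν : Measure (EuclideanSpace ℝ (Fin n))}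

/-- Closed sets are limits of thickened indicators, so Lipschitz test functions with values in
`[0, 1]` detect the total variation distance. -/
lemma measureReal_sub_le_of_lipschitz [IsFiniteMeasure μ] [IsFiniteMeasure ν] {D : ℝ}
    (hD : ∀ (h : EuclideanSpace ℝ (Fin n) → ℝ) (K : NNReal), LipschitzWith K h → (∀ x, 0 ≤ h x) →
      (∀ x, h x ≤ 1) → ∫ x, h x ∂μ ≤ ∫ x, h x ∂ν + D)
    {A : Set (EuclideanSpace ℝ (Fin n))} (hA : MeasurableSet A) :
    μ.real A - ν.real A ≤ D := by
  have hclosed : ∀ F : Set (EuclideanSpace ℝ (Fin n)), IsClosed F →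
      μ.real F ≤ ν.real F + D := by
    intro F hF
    have hpos : ∀ k : ℕ, (0 : ℝ) < 1 / (k + 1) := fun k => by positivity
    have l1 := tendsto_integral_thickenedIndicator_of_isClosed μ hF hpos
      tendsto_one_div_add_atTop_nhds_zero_nat
    have l2 := tendsto_integral_thickenedIndicator_of_isClosed ν hF hpos
      tendsto_one_div_add_atTop_nhds_zero_nat
    refine le_of_tendsto_of_tendsto' l1 (l2.add_const D) fun k => ?_
    exact hD _ _ (lipschitzWith_thickenedIndicator (hpos k) F) (fun x => NNReal.coe_nonneg _)
      fun x => thickenedIndicator_le_one (hpos k) F x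
  refine le_of_forall_pos_le_add fun η hη => ?_
  obtain ⟨F, hFA, -, hF, hμF⟩ := hA.exists_isCompact_isClosed_lt_add (measure_ne_top μ A)
    (ENNReal.ofReal_pos.2 hη).ne'
  have h1 : μ.real A ≤ μ.real F + η := by
    have := ENNReal.toReal_mono (by finiteness) hμF.le
    rwa [ENNReal.toReal_add (measure_ne_top _ _) ENNReal.ofReal_ne_top,
      ENNReal.toReal_ofReal hη.le] at this
  have h2 : ν.real F ≤ ν.real A := measureReal_mono hFA
  linarith [hclosed F hF]

lemma tvDist_le_of_lipschitz [IsFiniteMeasure μ] [IsFiniteMeasure ν] {D : ℝ}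
    (h1 : ∀ (h : EuclideanSpace ℝ (Fin n) → ℝ) (K : NNReal), LipschitzWith K h → (∀ x, 0 ≤ h x) →
      (∀ x, h x ≤ 1) → ∫ x, h x ∂μ ≤ ∫ x, h x ∂ν + D)
    (h2 : ∀ (h : EuclideanSpace ℝ (Fin n) → ℝ) (K : NNReal), LipschitzWith K h → (∀ x, 0 ≤ h x) →
      (∀ x, h x ≤ 1) → ∫ x, h x ∂ν ≤ ∫ x, h x ∂μ + D) :
    tvDist μ ν ≤ 2 * D := by
  refine mul_le_mul_of_nonneg_left (csSup_le ⟨_, ∅, MeasurableSet.empty, rfl⟩ ?_) zero_le_two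
  rintro _ ⟨A, hA, rfl⟩
  have e1 := measureReal_sub_le_of_lipschitz h1 hA
  have e2 := measureReal_sub_le_of_lipschitz h2 hA
  exact abs_le.2 ⟨by linarith, e1⟩

lemma blNorm_le_one {g : EuclideanSpace ℝ (Fin n) → ℝ} (h1 : ∀ x, |g x| ≤ 1)
    (h2 : ∀ x y, |g x - g y| ≤ ‖x - y‖) : blNorm g ≤ 1 := by
  refine max_le (iSup_le fun x => ?_) (iSup_le fun x => iSup_le fun y => iSup_le fun _ => ?_)
  · rw [Real.enorm_eq_ofReal_abs]
    simpa using h1 x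
  · refine ENNReal.div_le_of_le_mul ?_
    rw [one_mul, Real.enorm_eq_ofReal_abs, ← ofReal_norm]
    exact ENNReal.ofReal_le_ofReal (h2 x y)

lemma abs_integral_sub_le_two [IsProbabilityMeasure μ] [IsProbabilityMeasure ν]
    {g : EuclideanSpace ℝ (Fin n) → ℝ} (hg : blNorm g ≤ 1) :
    |∫ x, g x ∂μ - ∫ x, g x ∂ν| ≤ 2 := by
  have hb : ∀ x, ‖g x‖ ≤ 1 := fun x => by
    have h : ‖g x‖ₑ ≤ 1 := (le_iSup (fun x => ‖g x‖ₑ) x).trans ((le_max_left _ _).trans hg)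
    rw [Real.enorm_eq_ofReal_abs] at h
    simpa using h
  have h1 := norm_integral_le_of_norm_le_const (μ := μ) (ae_of_all _ hb)
  have h2 := norm_integral_le_of_norm_le_const (μ := ν) (ae_of_all _ hb)
  simp only [probReal_univ, mul_one, Real.norm_eq_abs] at h1 h2
  refine (abs_sub _ _).trans ?_
  linarith

lemma abs_integral_sub_le_blDist [IsProbabilityMeasure μ] [IsProbabilityMeasure ν]
    {g : EuclideanSpace ℝ (Fin n) → ℝ} (hg : blNorm g ≤ 1) :
    |∫ x, g x ∂μ - ∫ x, g x ∂ν| ≤ blDist μ ν := by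
  refine le_csSup ⟨2, ?_⟩ ⟨g, hg, rfl⟩
  rintro _ ⟨g, hg, rfl⟩
  exact abs_integral_sub_le_two hg

lemma blDist_le_two [IsProbabilityMeasure μ] [IsProbabilityMeasure ν] : blDist μ ν ≤ 2 := by
  refine Real.sSup_le ?_ zero_le_two
  rintro _ ⟨g, hg, rfl⟩
  exact abs_integral_sub_le_two hg

lemma blDist_nonneg (μ ν : Measure (EuclideanSpace ℝ (Fin n))) : 0 ≤ blDist μ ν := by
  refine Real.sSup_nonneg ?_
  rintro _ ⟨g, -, rfl⟩
  exact abs_nonneg _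

lemma blDist_comm (μ ν : Measure (EuclideanSpace ℝ (Fin n))) : blDist μ ν = blDist ν μ := by
  simp only [blDist, abs_sub_comm]

end Distances

/-! ### The comparison of distances -/

section Comparison

variable {n : ℕ} {μ ν : Measure (EuclideanSpace ℝ (Fin n))}
  [IsProbabilityMeasure μ] [IsProbabilityMeasure ν]

lemma integral_gaussianAverage_sub_le {t : ℝ} (ht : 0 < t) (ht7 : t ≤ 7)
    {h : EuclideanSpace ℝ (Fin n) → ℝ} (hm : Measurable h) (h0 : ∀ x, 0 ≤ h x)
    (h1 : ∀ x, h x ≤ 1) :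
    ∫ x, gaussianAverage t h x ∂μ ≤ ∫ x, gaussianAverage t h x ∂ν + 7 / t * blDist μ ν := by
  have hg : blNorm (fun x => t / 7 * gaussianAverage t h x) ≤ 1 := by
    refine blNorm_le_one (fun x => ?_) fun x y => ?_
    · rw [abs_of_nonneg (mul_nonneg (by positivity) (gaussianAverage_nonneg h0 x))]
      have := gaussianAverage_le_one (t := t) h0 h1 x
      have := gaussianAverage_nonneg (t := t) h0 x
      exact mul_le_one₀ (by linarith) this ‹_›
    · rw [← mul_sub, abs_mul, abs_of_pos (by positivity)]
      calc t / 7 * |gaussianAverage t h x - gaussianAverage t h y|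
          ≤ t / 7 * (7 / t * ‖x - y‖) := by
            gcongr
            exact abs_gaussianAverage_sub_le hm h0 h1 ht x y
        _ = ‖x - y‖ := by field_simp
  have hb := (le_abs_self _).trans (abs_integral_sub_le_blDist (μ := μ) (ν := ν) hg)
  rw [integral_const_mul, integral_const_mul, ← mul_sub] at hb
  have : 7 / t * (t / 7 * (∫ x, gaussianAverage t h x ∂μ - ∫ x, gaussianAverage t h x ∂ν))
      ≤ 7 / t * blDist μ ν := by gcongr
  have e : 7 / t * (t / 7 * (∫ x, gaussianAverage t h x ∂μ - ∫ x, gaussianAverage t h x ∂ν))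
      = ∫ x, gaussianAverage t h x ∂μ - ∫ x, gaussianAverage t h x ∂ν := by field_simp
  linarith

/-- A Lipschitz test function is compared between `μ` and `ν` through its Gaussian averages. -/
lemma integral_le_integral_add_of_isotropic (hn : 1 ≤ n) (hμ : IsLogConcaveMeasure μ)
    (hν : IsLogConcaveMeasure ν) (hμ' : IsIsotropicMeasure μ) (hν' : IsIsotropicMeasure ν)
    {t : ℝ} (ht : 0 < t) (ht7 : t ≤ 7) {h : EuclideanSpace ℝ (Fin n) → ℝ} {K : NNReal}
    (hK : LipschitzWith K h) (h0 : ∀ x, 0 ≤ h x) (h1 : ∀ x, h x ≤ 1) :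
    ∫ x, h x ∂μ ≤ ∫ x, h x ∂ν + (2 * smoothingConstant * (n * t) + 7 / t * blDist μ ν) := by
  have hm : Measurable h := hK.continuous.measurable
  have e1 := integral_le_integral_gaussianAverage_add hn hμ hμ' ht hK h0 h1
  have e2 := integral_gaussianAverage_sub_le (μ := μ) (ν := ν) ht ht7 hm h0 h1
  -- the complementary function `1 - h` gives the reverse estimate for `ν`
  have hK' : LipschitzWith K fun x => 1 - h x := by
    simpa using (LipschitzWith.const (1 : ℝ)).sub hK
  have e3 := integral_le_integral_gaussianAverage_add hn hν hν' ht hK'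
    (fun x => by linarith [h1 x]) (fun x => by linarith [h0 x])
  have hP : ∀ x, gaussianAverage t (fun x => 1 - h x) x = 1 - gaussianAverage t h x := fun x => by
    have hi : Integrable (fun v => h (x + t • v)) (gaussianKernel (EuclideanSpace ℝ (Fin n))) :=
      integrable_of_nonneg_of_le_one (hm.comp (by fun_prop)) (fun _ => h0 _) fun _ => h1 _
    simp only [gaussianAverage]
    rw [integral_sub (integrable_const _) hi]
    simp
  have hPlip : LipschitzWith (7 / t).toNNReal (gaussianAverage t h) :=
    LipschitzWith.of_dist_le_mul fun x y => by
      rw [Real.dist_eq, dist_eq_norm, Real.coe_toNNReal _ (by positivity)]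
      exact abs_gaussianAverage_sub_le hm h0 h1 ht x y
  simp only [hP] at e3
  rw [integral_sub (integrable_const _) (integrable_of_nonneg_of_le_one hm h0 h1),
    integral_sub (integrable_const _) (integrable_of_nonneg_of_le_one hPlip.continuous.measurable
      (gaussianAverage_nonneg h0) (gaussianAverage_le_one h0 h1))] at e3
  linarith

lemma tvDist_le_add (hn : 1 ≤ n) (hμ : IsLogConcaveMeasure μ) (hν : IsLogConcaveMeasure ν)
    (hμ' : IsIsotropicMeasure μ) (hν' : IsIsotropicMeasure ν) {t : ℝ} (ht : 0 < t) (ht7 : t ≤ 7) :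
    tvDist μ ν ≤ 2 * (2 * smoothingConstant * (n * t) + 7 / t * blDist μ ν) := by
  refine tvDist_le_of_lipschitz (fun h K hK h0 h1 => ?_) fun h K hK h0 h1 => ?_
  · exact integral_le_integral_add_of_isotropic hn hμ hν hμ' hν' ht ht7 hK h0 h1
  · rw [blDist_comm]
    exact integral_le_integral_add_of_isotropic hn hν hμ hν' hμ' ht ht7 hK h0 h1

end Comparison

theorem propositionT :
    ∃ C : ℝ, 0 < C ∧
      ∀ (n : ℕ) (μ ν : Measure (EuclideanSpace ℝ (Fin n)))
        [IsProbabilityMeasure μ] [IsProbabilityMeasure ν],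
        IsLogConcaveMeasure μ → IsLogConcaveMeasure ν →
        IsIsotropicMeasure μ → IsIsotropicMeasure ν →
          tvDist μ ν ≤ C * Real.sqrt (n * blDist μ ν) := by
  have hsc := smoothingConstant_pos
  refine ⟨2 * (2 * smoothingConstant + 7), by positivity, ?_⟩
  intro n μ ν _ _ hμ hν hμ' hν'
  rcases Nat.eq_zero_or_pos n with rfl | hn
  · -- in dimension zero there is only one probability measure
    have : tvDist μ ν ≤ 2 * 0 := by
      refine mul_le_mul_of_nonneg_left (Real.sSup_le ?_ le_rfl) zero_le_two
      rintro _ ⟨A, -, rfl⟩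
      rcases A.eq_empty_or_nonempty with rfl | hA
      · simp
      · simp [Subsingleton.eq_univ_of_nonempty hA]
    simpa using this
  have hn0 : (0 : ℝ) < n := by exact_mod_cast hn
  have hn1 : (1 : ℝ) ≤ n := by exact_mod_cast hn
  set d := blDist μ ν with hd
  have hd2 : d ≤ 2 := blDist_le_two
  rcases (blDist_nonneg μ ν).eq_or_lt with hd0 | hd0
  · rw [← hd] at hd0
    rw [← hd0, mul_zero, Real.sqrt_zero, mul_zero]
    refine le_of_forall_pos_le_add fun η hη => ?_
    set t := min 7 (η / (4 * smoothingConstant * n)) with ht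
    have ht0 : 0 < t := by positivity
    have h := tvDist_le_add hn hμ hν hμ' hν' ht0 (min_le_left _ _)
    rw [← hd, ← hd0, mul_zero, add_zero] at h
    calc tvDist μ ν ≤ 4 * smoothingConstant * n * t := by linarith
      _ ≤ 4 * smoothingConstant * n * (η / (4 * smoothingConstant * n)) := by
          gcongr
          exact min_le_right _ _
      _ = 0 + η := by field_simp; ring
  · -- the two error terms balance at `t = √(d / n)`
    set q := Real.sqrt (n * d) with hq
    have hq0 : 0 < q := Real.sqrt_pos.2 (by positivity)
    have hqq : q * q = n * d := Real.mul_self_sqrt (by positivity)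
    have hqn : q / n ≤ 7 := by
      rw [div_le_iff₀ hn0]
      by_contra! hlt
      nlinarith
    have h := tvDist_le_add hn hμ hν hμ' hν' (t := q / n) (by positivity) hqn
    have e1 : n * (q / n) = q := by field_simp
    have e2 : 7 / (q / n) * blDist μ ν = 7 * q := by
      rw [← hd]
      field_simp
      linarith
    rw [e1, e2] at h
    linarith
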